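/- Let $K$ be a number field with algebraic closure $\overline K$, and let $\varphi=p/q\in K(x)$ have degree $2$, where $p,q\in K[x]$ are coprime with $\max(\deg p,\deg q)=2$. Let $P,Q\in K[X,Y]$ be the homogenizations of $p,q$ in degree $2$, put $P_0=X$, $Q_0=Y$, $P_n=P_{n-1}(P,Q)$, $Q_n=Q_{n-1}(P,Q)$, and $p_n(x)=P_n(x,1)$. Let $K_n\subset\overline K$ be the field generated over $K$ by the roots of $p_n$, and write $\ell(f)$ for the leading coefficient of a polynomial $f$. Let $c=qp'-pq'$; a finite point $\gamma$ is critical for $\varphi$ iff $c(\gamma)=0$, and $\infty$ is critical iff the coefficient of $x^2$ in $c$ is $0$. (1) Let $n\ge 2$, suppose that $\varphi^n(\infty)\ne 0$ and $\varphi^{n-1}(\infty)\neq 0$ and that $p_{n-1}$ is irreducible in $K[x]$. Let $\gamma_1\ne\gamma_2\in\mathbb P^1(\overline K)$ be the critical points of $\varphi$, numbered so that $\varphi(\gamma_1)\neq\infty$. Then $K_{n-1}\subseteq K_n$. If $\varphi(\gamma_2)\ne\infty$, then $$[K_n:K_{n-1}]=2^{2^{n-1}}\iff p_{n-1}(\varphi(\gamma_1))\,p_{n-1}(\varphi(\gamma_2))\text{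 is not a square in }K_{n-1}.$$ If $\varphi(\gamma_2)=\infty$, then $$[K_n:K_{n-1}]=2^{2^{n-1}}\iff \ell(p_{n-1})\,p_{n-1}(\varphi(\gamma_1))\text{ is not a square in }K_{n-1}.$$ (Here $0$ counts as a square.) (2) Let $n\ge 1$, suppose that $\varphi^m(\infty)\neq 0$ for all $m\ge1$, that $p_{n-1}$ is irreducible in $K[x]$, and that $\varphi$ has two distinct finite critical points $\gamma_1,\gamma_2\in\overline K$, with $\varphi(\gamma_i)\ne\infty$ for $i=1,2$. Suppose that there is a prime $\mathfrak p$ of $K$ such that $v_{\mathfrak p}(p_n(\gamma_1)p_n(\gamma_2))$ is odd (so this element of $K$ is nonzero) and $$0=v_{\mathfrak p}(\ell(p))=v_{\mathfrak p}(\ell(c))=v_{\mathfrak p}(\operatorname{Res}(q,p))=v_{\mathfrak p}(\operatorname{Disc} p)=v_{\mathfrak p}(p_j(\gamma_i))\qquad(1\le i\le2,\ 2\le j\le n-1),$$ where for the elements $p_j(\gamma_i)\in\overline K$ the valuation is any fixed extension of $v_{\mathfrak p}$ to $\overline K$. Then $K_{n-1}\subseteq K_n$ and $[K_n:K_{n-1}]=2^{2^{n-1}}$.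 -/

import Mathlib

open Polynomial OnePoint

noncomputable section

namespace RatDyn

variable {K : Type*} [Field K]

/-- The degree of the rational function `φ = p / q` (for coprime `p`, `q`). -/
def deg (p q : K[X]) : ℕ := max p.natDegree q.natDegree

/-- The pair `(P_n, Q_n)` of binary forms: the components of the `n`-th iterate of the lift
`Φ = (P, Q) : 𝔸² → 𝔸²` of `φ = p / q`, where `P`, `Q` are the homogenizations of `p`, `q`
in degree `deg φ`, with `P_{n+1} = P_n(P, Q)` and `Q_{n+1} = Q_n(P, Q)`. -/
def liftIter (p q : K[X]) : ℕ → MvPolynomial (Fin 2) K × MvPolynomial (Fin 2) K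
  | 0 => (MvPolynomial.X 0, MvPolynomial.X 1)
  | n + 1 =>
    (MvPolynomial.bind₁ ![p.homogenize (deg p q), q.homogenize (deg p q)] (liftIter p q n).1,
     MvPolynomial.bind₁ ![p.homogenize (deg p q), q.homogenize (deg p q)] (liftIter p q n).2)

/-- The polynomial `p_n(x) = P_n(x, 1)`. -/
def iterNum (p q : K[X]) (n : ℕ) : K[X] :=
  MvPolynomial.aeval ![(X : K[X]), 1] (liftIter p q n).1

/-- The self-map of `ℙ¹(L) = L ∪ {∞}` given by `φ = p / q` (for coprime `p`, `q`), where `L` is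
an extension of `K`. -/
def ratMap (p q : K[X]) (L : Type*) [Field L] [Algebra K L] : OnePoint L → OnePoint L := fun γ =>
  open Classical in
  γ.elim
    (if q.coeff (deg p q) = 0 then (∞ : OnePoint L)
      else ((algebraMap K L (p.coeff (deg p q) / q.coeff (deg p q)) : L) : OnePoint L))
    (fun x : L => if aeval x q = 0 then (∞ : OnePoint L)
      else ((aeval x p / aeval x q : L) : OnePoint L))

/-- The polynomial `c = q p' - p q'`. -/
def critPoly (p q : K[X]) : K[X] := q * derivative p - p * derivative q

/-- `γ ∈ ℙ¹(L)` is a critical point of `φ = p / q`: it is a zero of the binary form of degree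
`2 deg φ - 2` whose dehomogenization is `c = q p' - p q'`. Hence a finite `γ` is critical iff
`c(γ) = 0`, and `∞` is critical iff the coefficient of `x ^ (2 deg φ - 2)` in `c` vanishes. -/
def IsCritical (p q : K[X]) {L : Type*} [Field L] [Algebra K L] (γ : OnePoint L) : Prop :=
  γ.elim ((critPoly p q).coeff (2 * deg p q - 2) = 0)
    (fun x : L => aeval x (critPoly p q) = 0)

/-- `K_n`, the field generated over `K` by the roots of `p_n` in the algebraic closure of `K`. -/
def iterField (p q : K[X]) (n : ℕ) : IntermediateField K (AlgebraicClosure K) :=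
  IntermediateField.adjoin K ((iterNum p q n).rootSet (AlgebraicClosure K))

end RatDyn

end

/-!
The proof compares the degree of `K_{n+1}` over `K_n` with one discriminant.

If `φⁿ(∞)` and `φⁿ⁺¹(∞)` are nonzero, the roots of `p_{n+1}` are the points of the fibers of `φ`
over the roots `α` of `p_n`, that is, the roots of the quadratics `p - α q`. Hence `K_{n+1}`
arises from `K_n` by adjoining the square roots of the `2 ^ n` discriminants `δ(α)` of these
quadratics (`RatDyn.iterField_succ`). By Kummer theory the degree is less than `2 ^ 2 ^ n` exactly
if a nonempty subproduct of the `δ(α)` is a square in `K_n`. If no `δ(α)` vanishes, the sets of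
roots `α` whose subproduct is a square form a representation over the field with two elements of
the Galois group of `K_n` over `K`. The image of this group in the permutations of the roots is a
`2`-group, and it is transitive because `p_n` is irreducible. A nonzero representation of a
`2`-group over the field with two elements has a nonzero fixed vector, and by transitivity this
can only be the set of all roots (`Finset.univ_mem_of_isPGroup_two`). So the degree is maximal if
and only if the product of all the `δ(α)` is not a square in `K_n`
(`RatDyn.relfinrank_iterField_succ`).

The discriminant `δ(t)` of `p - t q` is a polynomial of degree at most two in `t`, which vanishes
exactly at the finite critical values of `φ`. Writing it as a constant times `(t - t₁)(t - t₂)`,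
or times `t - t₁` if the other critical value is `∞`, and multiplying over all the roots of `p_n`
turns the product of the `δ(α)` into `p_n(t₁) p_n(t₂)`, or `ℓ(p_n) p_n(t₁)`, up to a square of `K`
(`RatDyn.exists_prod_fiberDisc_eq`, `RatDyn.exists_prod_fiberDisc_eq_of_infty`). This is the
criterion.

For the sufficient condition with `n ≥ 2`, `p_n(γ₁) p_n(γ₂)` and `p_{n-1}(φ(γ₁)) p_{n-1}(φ(γ₂))`
differ by a square of `K`, so it is enough that no element of `K` of odd valuation at `𝔭` becomes
a square in `K_{n-1}`. This is shown with an extension `v` of the valuation to the algebraic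
closure, through two facts: every value of `v` on `K_{n-2}` is the value of an element of `K`, and
every `v(δ(α))` with `p_{n-2}(α) = 0` is the value of a square of `K`. Both come from the
coordinates `p = a (x - α₁)(x - α₂)`, `q = Q p + U x + V` (`RatDyn.UnitModel`), where
`δ(t) = δ(0) (1 - t τ₁)(1 - t τ₂)` with `δ(0)` a unit and `τᵢ = q(γᵢ) / p(γᵢ)`. If `p` and `q` are integral at
`𝔭`, then `p_{k+1}(γᵢ)` being a unit implies that no root `α` of `p_k` reduces to `τᵢ⁻¹`, so that
the quadratics `p - α q`, scaled to be primitive, have unit discriminants and their roots do not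
enlarge the value group (`RatDyn.exists_val_add_mul_deriv_eq`). The polynomial `q` is not assumed to be integral; but the unit conditions at the
levels two and three force it to be (`RatDyn.val_le_one_of_orbit`), and the two lowest levels are
treated by direct computation.
-/

/-! ### Multiquadratic extensions -/

section MultiQuadratic

open IntermediateField

variable {k L : Type*} [Field k] [Field L] [Algebra k L]

theorem IntermediateField.exists_eq_add_mul_of_mem_sup_adjoin_sqrt
    (E : IntermediateField k L) {s : L} (hs : s ^ 2 ∈ E) {z : L} (hz : z ∈ E ⊔ k⟮s⟯) :
    ∃ u ∈ E, ∃ v ∈ E, z = u + v * s := by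
  have hle : E ⊔ k⟮s⟯ ≤ adjoin k ((E : Set L) ∪ {s}) := by
    rw [adjoin_union, adjoin_self]
  have hz' := hle hz
  clear hz
  induction hz' using adjoin_induction with
  | mem x hx =>
    rcases hx with hx | hx
    · exact ⟨x, hx, 0, zero_mem _, by simp⟩
    · exact ⟨0, zero_mem _, 1, one_mem _, by simpa using hx⟩
  | algebraMap x => exact ⟨_, E.algebraMap_mem x, 0, zero_mem _, by simp⟩
  | add x y _ _ hx hy =>
    obtain ⟨u, hu, v, hv, rfl⟩ := hx
    obtain ⟨u', hu', v', hv', rfl⟩ := hy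
    exact ⟨u + u', add_mem hu hu', v + v', add_mem hv hv', by ring⟩
  | mul x y _ _ hx hy =>
    obtain ⟨u, hu, v, hv, rfl⟩ := hx
    obtain ⟨u', hu', v', hv', rfl⟩ := hy
    exact ⟨u * u' + v * v' * s ^ 2,
      add_mem (mul_mem hu hu') (mul_mem (mul_mem hv hv') hs), u * v' + v * u',
      add_mem (mul_mem hu hv') (mul_mem hv hu'), by ring⟩
  | inv x _ hx =>
    obtain ⟨u, hu, v, hv, rfl⟩ := hx
    by_cases hN : u ^ 2 - v ^ 2 * s ^ 2 = 0
    · -- either the element vanishes, or it equals `2 * u` and already lies in `E`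
      have hmul : (u + v * s) * (u - v * s) = 0 := by linear_combination hN
      rcases mul_eq_zero.1 hmul with h | h
      · exact ⟨0, zero_mem _, 0, zero_mem _, by simp [h]⟩
      · refine ⟨(2 * u)⁻¹, inv_mem (mul_mem (ofNat_mem _ 2) hu), 0, zero_mem _, ?_⟩
        rw [show u + v * s = 2 * u by linear_combination -h]
        simp
    · have hNm : u ^ 2 - v ^ 2 * s ^ 2 ∈ E :=
        sub_mem (pow_mem hu 2) (mul_mem (pow_mem hv 2) hs)
      refine ⟨u / (u ^ 2 - v ^ 2 * s ^ 2), div_mem hu hNm,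
        -v / (u ^ 2 - v ^ 2 * s ^ 2), div_mem (neg_mem hv) hNm, ?_⟩
      have hne : u + v * s ≠ 0 := fun h => hN (by linear_combination (u - v * s) * h)
      field_simp
      ring

theorem IntermediateField.relfinrank_sup_adjoin_sqrt_le
    (E : IntermediateField k L) {s : L} (hs : s ^ 2 ∈ E) :
    0 < E.relfinrank (E ⊔ k⟮s⟯) ∧ E.relfinrank (E ⊔ k⟮s⟯) ≤ 2 := by
  have hle : E ≤ E ⊔ k⟮s⟯ := le_sup_left
  have hsm : s ∈ E ⊔ k⟮s⟯ := (le_sup_right : k⟮s⟯ ≤ _) (mem_adjoin_simple_self k s)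
  rw [relfinrank_eq_finrank_of_le hle]
  let f : (E × E) →ₗ[E] extendScalars hle :=
    LinearMap.coprod (LinearMap.toSpanSingleton E _ 1)
      (LinearMap.toSpanSingleton E _ (⟨s, hsm⟩ : extendScalars hle))
  have hf : Function.Surjective f := by
    rintro ⟨z, hz⟩
    obtain ⟨u, hu, v, hv, rfl⟩ := E.exists_eq_add_mul_of_mem_sup_adjoin_sqrt hs hz
    refine ⟨(⟨u, hu⟩, ⟨v, hv⟩), Subtype.ext ?_⟩
    simp [f, Algebra.smul_def]
  have : Module.Finite E (extendScalars hle) := Module.Finite.of_surjective f hf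
  refine ⟨Module.finrank_pos, ?_⟩
  have := LinearMap.finrank_le_finrank_of_surjective hf
  simpa using this

variable {ι : Type*} [DecidableEq ι]

theorem IntermediateField.sup_adjoin_image_insert (F : IntermediateField k L) (s : ι → L)
    (j : ι) (S : Finset ι) :
    F ⊔ adjoin k (s '' (insert j S : Finset ι)) = (F ⊔ adjoin k (s '' S)) ⊔ k⟮s j⟯ := by
  rw [Finset.coe_insert, Set.image_insert_eq, Set.insert_eq, adjoin_union, sup_comm k⟮s j⟯,
    sup_assoc]

/-- Kummer theory for exponent two: an element of `F` that becomes a square after adjoining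
square roots of the `a i` is, up to a square of `F`, a product of some of the `a i`. -/
theorem IntermediateField.exists_mul_prod_eq_sq [NeZero (2 : L)]
    (F : IntermediateField k L) (a s : ι → L) (ha : ∀ i, a i ∈ F) (hs : ∀ i, s i ^ 2 = a i)
    (S : Finset ι) {x y : L} (hx : x ∈ F) (hy : y ∈ F ⊔ adjoin k (s '' S)) (hxy : y ^ 2 = x) :
    ∃ T ⊆ S, ∃ z ∈ F, z ^ 2 = x * ∏ i ∈ T, a i := by
  induction S using Finset.induction_on generalizing x y with
  | empty => exact ⟨∅, by simp, y, by simpa using hy, by simpa using hxy⟩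
  | insert j S hj ih =>
    rw [sup_adjoin_image_insert] at hy
    set E := F ⊔ adjoin k (s '' S)
    have hFE : F ≤ E := le_sup_left
    have hsE : s j ^ 2 ∈ E := hFE (hs j ▸ ha j)
    obtain ⟨u, hu, v, hv, rfl⟩ := E.exists_eq_add_mul_of_mem_sup_adjoin_sqrt hsE hy
    have hcross : s j ∈ E ∨ u * v = 0 := by
      by_contra! h
      refine h.1 ?_
      have : s j = (x - u ^ 2 - v ^ 2 * s j ^ 2) / (2 * (u * v)) := by
        have h2 : (2 : L) ≠ 0 := NeZero.ne 2
        have := h.2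
        rw [eq_div_iff (by simp [h2, this])]
        linear_combination hxy
      rw [this]
      exact div_mem (sub_mem (sub_mem (hFE hx) (pow_mem hu 2)) (mul_mem (pow_mem hv 2) hsE))
        (mul_mem (ofNat_mem _ 2) (mul_mem hu hv))
    rcases hcross with h | h
    · obtain ⟨T, hT, z, hz, e⟩ := ih hx (add_mem hu (mul_mem hv h)) hxy
      exact ⟨T, hT.trans (Finset.subset_insert _ _), z, hz, e⟩
    · rcases mul_eq_zero.1 h with rfl | rfl
      · obtain ⟨T, hT, z, hz, e⟩ := ih (x := x * a j) (y := v * a j) (mul_mem hx (ha j))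
          (mul_mem hv (hFE (ha j))) (by rw [← hxy, ← hs j]; ring)
        refine ⟨insert j T, Finset.insert_subset_insert _ hT, z, hz, ?_⟩
        rw [Finset.prod_insert (fun h => hj (hT h)), e, mul_assoc]
      · obtain ⟨T, hT, z, hz, e⟩ := ih hx hu (by simpa using hxy)
        exact ⟨T, hT.trans (Finset.subset_insert _ _), z, hz, e⟩

theorem IntermediateField.relfinrank_sup_adjoin_sqrts_le
    (F : IntermediateField k L) (a s : ι → L) (ha : ∀ i, a i ∈ F) (hs : ∀ i, s i ^ 2 = a i)
    (S : Finset ι) :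
    F.relfinrank (F ⊔ adjoin k (s '' S)) ≤ 2 ^ S.card := by
  induction S using Finset.induction_on with
  | empty => simp [relfinrank_self]
  | insert j S hj ih =>
    rw [sup_adjoin_image_insert, Finset.card_insert_of_notMem hj, pow_succ,
      ← relfinrank_mul_relfinrank le_sup_left le_sup_left]
    exact Nat.mul_le_mul ih
      (relfinrank_sup_adjoin_sqrt_le _ ((le_sup_left : F ≤ _) (hs j ▸ ha j))).2

/-- If no nonempty product of the `a i` is a square in `F`, then adjoining their square roots
gives an extension of the maximal degree. -/
theorem IntermediateField.relfinrank_sup_adjoin_sqrts_eq [NeZero (2 : L)]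
    (F : IntermediateField k L) (a s : ι → L) (ha : ∀ i, a i ∈ F) (hs : ∀ i, s i ^ 2 = a i)
    (S : Finset ι) (h : ∀ T ⊆ S, T.Nonempty → ¬ ∃ z ∈ F, z ^ 2 = ∏ i ∈ T, a i) :
    F.relfinrank (F ⊔ adjoin k (s '' S)) = 2 ^ S.card := by
  induction S using Finset.induction_on with
  | empty => simp [relfinrank_self]
  | insert j S hj ih =>
    rw [sup_adjoin_image_insert, Finset.card_insert_of_notMem hj, pow_succ,
      ← relfinrank_mul_relfinrank le_sup_left le_sup_left,
      ih fun T hT => h T (hT.trans (Finset.subset_insert _ _))]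
    congr 1
    set E := F ⊔ adjoin k (s '' S)
    have hb := relfinrank_sup_adjoin_sqrt_le E ((le_sup_left : F ≤ E) (hs j ▸ ha j))
    have hne : E.relfinrank (E ⊔ k⟮s j⟯) ≠ 1 := by
      rw [Ne, relfinrank_eq_one_iff]
      intro hle
      have hsj : s j ∈ E := hle ((le_sup_right : k⟮s j⟯ ≤ _) (mem_adjoin_simple_self k (s j)))
      obtain ⟨T, hT, z, hz, e⟩ := F.exists_mul_prod_eq_sq a s ha hs S (ha j) hsj (hs j)
      refine h (insert j T) (Finset.insert_subset_insert _ hT) (by simp) ⟨z, hz, ?_⟩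
      rw [Finset.prod_insert (fun h => hj (hT h)), e]
    omega

/-- If the product of all the `a i` is a square in `F`, then the degree is not maximal. -/
theorem IntermediateField.relfinrank_sup_adjoin_sqrts_lt
    (F : IntermediateField k L) (a s : ι → L) (ha : ∀ i, a i ∈ F) (hs : ∀ i, s i ^ 2 = a i)
    (S : Finset ι) (hS : S.Nonempty) (h : ∃ z ∈ F, z ^ 2 = ∏ i ∈ S, a i) :
    F.relfinrank (F ⊔ adjoin k (s '' S)) < 2 ^ S.card := by
  -- one of the square roots is superfluous: it is `±z` divided by the product of the others
  -- (or zero)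
  obtain ⟨z, hz, hzS⟩ := h
  have key : ∃ j ∈ S, s j ∈ F ⊔ adjoin k (s '' (S.erase j)) := by
    by_cases h0 : ∃ j ∈ S, a j = 0
    · obtain ⟨j, hj, hj0⟩ := h0
      refine ⟨j, hj, ?_⟩
      have : s j = 0 := by simpa [hj0] using hs j
      rw [this]; exact zero_mem _
    · push Not at h0
      obtain ⟨j, hj⟩ := hS
      refine ⟨j, hj, ?_⟩
      set E := F ⊔ adjoin k (s '' (S.erase j))
      have hFE : F ≤ E := le_sup_left
      set m := ∏ i ∈ S.erase j, s i
      have hm : m ∈ E := prod_mem fun i hi =>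
        (le_sup_right : adjoin k (s '' (S.erase j)) ≤ E)
          (subset_adjoin k _ ⟨i, by simpa [and_comm] using hi, rfl⟩)
      have hm0 : m ≠ 0 := Finset.prod_ne_zero_iff.2 fun i hi e =>
        h0 i (Finset.mem_of_mem_erase hi) (by rw [← hs i, e]; simp)
      have hsq : (s j * m) ^ 2 = z ^ 2 := by
        rw [Finset.mul_prod_erase S s hj, hzS, ← Finset.prod_pow]
        exact Finset.prod_congr rfl fun i _ => hs i
      rcases sq_eq_sq_iff_eq_or_eq_neg.1 hsq with e | e
      · rw [eq_div_of_mul_eq hm0 e]; exact div_mem (hFE hz) hm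
      · rw [eq_div_of_mul_eq hm0 e]; exact div_mem (neg_mem (hFE hz)) hm
  obtain ⟨j, hj, hsj⟩ := key
  rw [← Finset.insert_erase hj, sup_adjoin_image_insert, sup_eq_left.2 (by simpa using hsj),
    Finset.insert_erase hj]
  refine (F.relfinrank_sup_adjoin_sqrts_le a s ha hs _).trans_lt ?_
  rw [Finset.card_erase_of_mem hj]
  exact Nat.pow_lt_pow_right (by norm_num)
    (Nat.sub_lt (Finset.card_pos.2 ⟨j, hj⟩) one_pos)

end MultiQuadratic

/-! ### Transitive `2`-groups -/

section FixedPoint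

/-- Let a transitive `2`-group of permutations act on the subsets of a finite set. A family of
subsets that is stable under the group and under symmetric difference is a representation over
the field with two elements, so if it is nonzero it has a nonzero fixed vector, which can only
be the full set. -/
theorem Finset.univ_mem_of_isPGroup_two {A : Type*} [Fintype A] [DecidableEq A]
    (H : Subgroup (Equiv.Perm A)) (hH : IsPGroup 2 H) (htr : ∀ a b : A, ∃ h ∈ H, h a = b)
    (W : Set (Finset A)) (hW0 : ∅ ∈ W)
    (hWd : ∀ S ∈ W, ∀ T ∈ W, symmDiff S T ∈ W)
    (hWH : ∀ h ∈ H, ∀ S ∈ W, S.map (Equiv.toEmbedding h) ∈ W)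
    {S : Finset A} (hS : S ∈ W) (hSne : S.Nonempty) : Finset.univ ∈ W := by
  classical
  let act : MulAction H W :=
    { smul := fun h T => ⟨T.1.map (Equiv.toEmbedding h.1), hWH _ h.2 _ T.2⟩
      one_smul := fun T => Subtype.ext (by
        change T.1.map (Function.Embedding.refl A) = T.1
        exact Finset.map_refl)
      mul_smul := fun g h T => Subtype.ext (by
        change T.1.map _ = (T.1.map _).map _
        rw [Finset.map_map]; rfl) }
  have hsmul : ∀ (h : H) (T : W), ((h • T : W) : Finset A) = T.1.map (Equiv.toEmbedding h.1) :=
    fun _ _ => rfl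
  have : Fact (Nat.Prime 2) := ⟨Nat.prime_two⟩
  have hmod := hH.card_modEq_card_fixedPoints (α := W)
  -- translation by a nonempty member is an involution without fixed points
  have heven : 2 ∣ Nat.card W := by
    let f : Function.End W := fun T => ⟨symmDiff S T.1, hWd _ hS _ T.2⟩
    have hf : f ^ 2 ^ 1 = 1 := by
      funext T
      apply Subtype.ext
      change symmDiff S (symmDiff S T.1) = T.1
      exact symmDiff_symmDiff_cancel_left S T.1
    have hfix := Equiv.Perm.card_fixedPoints_modEq (p := 2) (n := 1) hf
    have hempty : IsEmpty (Function.fixedPoints f) := by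
      refine ⟨fun ⟨T, hT⟩ => hSne.ne_empty ?_⟩
      have : symmDiff S T.1 = T.1 := congrArg Subtype.val hT
      simpa using this
    rw [Fintype.card_eq_zero (α := Function.fixedPoints f)] at hfix
    rw [Nat.card_eq_fintype_card]
    exact (Nat.modEq_zero_iff_dvd).1 hfix
  have hfixed : 2 ∣ Nat.card (MulAction.fixedPoints H W) :=
    (Nat.modEq_zero_iff_dvd).1 (hmod.symm.trans ((Nat.modEq_zero_iff_dvd).2 heven))
  have hmem0 : (⟨∅, hW0⟩ : W) ∈ MulAction.fixedPoints H W := fun h =>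
    Subtype.ext (by rw [hsmul]; simp)
  have hpos : 0 < Nat.card (MulAction.fixedPoints H W) :=
    Nat.card_pos_iff.2 ⟨⟨⟨_, hmem0⟩⟩, inferInstance⟩
  have hlt : 1 < Nat.card (MulAction.fixedPoints H W) := by
    have := Nat.le_of_dvd hpos hfixed
    omega
  rw [Finite.one_lt_card_iff_nontrivial] at hlt
  obtain ⟨⟨T, hT⟩, hne⟩ := exists_ne (⟨_, hmem0⟩ : MulAction.fixedPoints H W)
  have hTne : T.1.Nonempty := by
    rw [Finset.nonempty_iff_ne_empty]
    exact fun e => hne (Subtype.ext (Subtype.ext e))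
  obtain ⟨x, hx⟩ := hTne
  have : T.1 = Finset.univ := by
    refine Finset.eq_univ_of_forall fun y => ?_
    obtain ⟨h, hh, rfl⟩ := htr x y
    have e := congrArg Subtype.val (hT ⟨h, hh⟩)
    rw [hsmul] at e
    rw [← e]
    exact Finset.mem_map_of_mem _ hx
  exact this ▸ T.2

end FixedPoint

/-! ### The lift of a quadratic rational function and its iterates -/

namespace RatDyn

section Forms

variable {K : Type*} [Field K] {R S : Type*} [CommRing R] [Algebra K R] [CommRing S] [Algebra K S]

/-- The value at `v = (x, y)` of the homogenization of `f` in degree two (for `f` of degree at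
most two). -/
def form (f : K[X]) (v : R × R) : R :=
  algebraMap K R (f.coeff 2) * v.1 ^ 2 + algebraMap K R (f.coeff 1) * (v.1 * v.2) +
    algebraMap K R (f.coeff 0) * v.2 ^ 2

/-- The lift `Φ = (P, Q) : R² → R²` of the quadratic rational function `p / q`. -/
def liftMap (p q : K[X]) (v : R × R) : R × R := (form p v, form q v)

theorem eq_of_natDegree_le_two {f : K[X]} (hf : f.natDegree ≤ 2) :
    f = C (f.coeff 0) + C (f.coeff 1) * X + C (f.coeff 2) * X ^ 2 := by
  conv_lhs => rw [f.as_sum_range_C_mul_X_pow' (n := 3) (by omega)]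
  simp [Finset.sum_range_succ]

theorem aeval_homogenize_two {f : K[X]} (hf : f.natDegree ≤ 2) (v : R × R) :
    MvPolynomial.aeval ![v.1, v.2] (f.homogenize 2) = form f v := by
  conv_lhs => rw [eq_of_natDegree_le_two hf]
  simp only [homogenize_add, homogenize_C_mul, homogenize_C, homogenize_X_pow (le_refl 2),
    homogenize_X (two_ne_zero), map_add, map_mul, map_pow, MvPolynomial.aeval_X,
    MvPolynomial.aeval_C, form]
  simp
  ring

theorem aeval_eq_form {f : K[X]} (hf : f.natDegree ≤ 2) (x : R) :
    aeval x f = form f (x, 1) := by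
  conv_lhs => rw [eq_of_natDegree_le_two hf]
  simp [form]
  ring

theorem natDegree_le_of_deg {p q : K[X]} (h : deg p q = 2) :
    p.natDegree ≤ 2 ∧ q.natDegree ≤ 2 := by
  unfold deg at h; omega

theorem map_form (g : R →ₐ[K] S) (f : K[X]) (v : R × R) :
    g (form f v) = form f (g v.1, g v.2) := by
  simp [form]

theorem map_liftMap_iterate (g : R →ₐ[K] S) (p q : K[X]) (n : ℕ) (v : R × R) :
    Prod.map g g ((liftMap p q)^[n] v) = (liftMap p q)^[n] (Prod.map g g v) := by
  induction n generalizing v with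
  | zero => rfl
  | succ n ih =>
    rw [Function.iterate_succ_apply, Function.iterate_succ_apply, ih]
    congr 1
    simp [liftMap, map_form, Prod.map]

theorem aeval_liftIter {p q : K[X]} (hd : deg p q = 2) (n : ℕ) (v : R × R) :
    (MvPolynomial.aeval ![v.1, v.2] (liftIter p q n).1,
      MvPolynomial.aeval ![v.1, v.2] (liftIter p q n).2) = (liftMap p q)^[n] v := by
  induction n generalizing v with
  | zero => simp [liftIter]
  | succ n ih =>
    obtain ⟨hp, hq⟩ := natDegree_le_of_deg hd
    have hfun : (fun i : Fin 2 => MvPolynomial.aeval ![v.1, v.2]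
        ((![p.homogenize (deg p q), q.homogenize (deg p q)] : Fin 2 → _) i)) =
        ![(liftMap p q v).1, (liftMap p q v).2] := by
      funext i
      fin_cases i
      · simpa [hd, liftMap] using aeval_homogenize_two hp v
      · simpa [hd, liftMap] using aeval_homogenize_two hq v
    rw [Function.iterate_succ_apply, ← ih, liftIter]
    simp only [MvPolynomial.aeval_bind₁, hfun]

/-- `p_n` is the first component of `Φⁿ(X, 1)`. -/
theorem iterNum_eq {p q : K[X]} (hd : deg p q = 2) (n : ℕ) :
    iterNum p q n = ((liftMap p q)^[n] ((X : K[X]), (1 : K[X]))).1 := by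
  rw [← aeval_liftIter hd]
  rfl

theorem aeval_iterNum {p q : K[X]} (hd : deg p q = 2) (n : ℕ) (x : R) :
    aeval x (iterNum p q n) = ((liftMap p q)^[n] (x, 1)).1 := by
  have h := congrArg Prod.fst (map_liftMap_iterate (aeval x : K[X] →ₐ[K] R) p q n (X, 1))
  rw [iterNum_eq hd]
  simpa using h

theorem iterNum_zero (p q : K[X]) : iterNum p q 0 = X := by
  simp [iterNum, liftIter]

theorem form_smul (f : K[X]) (c : R) (v : R × R) : form f (c • v) = c ^ 2 * form f v := by
  simp only [form, Prod.smul_fst, Prod.smul_snd, smul_eq_mul]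
  ring

theorem liftMap_iterate_smul (p q : K[X]) (n : ℕ) (c : R) (v : R × R) :
    (liftMap p q)^[n] (c • v) = c ^ 2 ^ n • (liftMap p q)^[n] v := by
  induction n generalizing c v with
  | zero => simp
  | succ n ih =>
    have : liftMap p q (c • v) = c ^ 2 • liftMap p q v := by
      simp [liftMap, form_smul]
    rw [Function.iterate_succ_apply, this, ih, Function.iterate_succ_apply, ← pow_mul, pow_succ']

theorem natDegree_form_le (f a b : K[X]) (m : ℕ) (ha : a.natDegree ≤ m) (hb : b.natDegree ≤ m) :
    (form f (a, b)).natDegree ≤ m + m ∧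
      (form f (a, b)).coeff (m + m) = form f (a.coeff m, b.coeff m) := by
  have key : ∀ (c : K) (a b : K[X]), a.natDegree ≤ m → b.natDegree ≤ m →
      (algebraMap K K[X] c * (a * b)).natDegree ≤ m + m ∧
      (algebraMap K K[X] c * (a * b)).coeff (m + m) = c * (a.coeff m * b.coeff m) := by
    intro c a b ha hb
    refine ⟨(natDegree_C_mul_le _ _).trans (natDegree_mul_le_of_le ha hb), ?_⟩
    rw [← coeff_mul_add_eq_of_natDegree_le ha hb]
    exact coeff_C_mul _
  unfold form
  simp only [sq]
  refine ⟨natDegree_add_le_of_degree_le (natDegree_add_le_of_degree_le ?_ ?_) ?_, ?_⟩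
  · exact (key _ _ _ ha ha).1
  · exact (key _ _ _ ha hb).1
  · exact (key _ _ _ hb hb).1
  · rw [coeff_add, coeff_add, (key _ _ _ ha ha).2, (key _ _ _ ha hb).2, (key _ _ _ hb hb).2]
    rfl

theorem natDegree_liftMap_iterate (p q : K[X]) (n : ℕ) :
    let F : K[X] × K[X] := (liftMap p q)^[n] (X, 1)
    F.1.natDegree ≤ 2 ^ n ∧ F.2.natDegree ≤ 2 ^ n ∧
      (F.1.coeff (2 ^ n), F.2.coeff (2 ^ n)) = (liftMap p q)^[n] ((1 : K), (0 : K)) := by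
  induction n with
  | zero => simp [coeff_one]
  | succ n ih =>
    obtain ⟨h1, h2, h3⟩ := ih
    simp only [Function.iterate_succ_apply', pow_succ, mul_two]
    rw [← h3]
    have e1 := natDegree_form_le p _ _ _ h1 h2
    have e2 := natDegree_form_le q _ _ _ h1 h2
    exact ⟨e1.1, e2.1, Prod.ext e1.2 e2.2⟩

theorem natDegree_iterNum_le {p q : K[X]} (hd : deg p q = 2) (n : ℕ) :
    (iterNum p q n).natDegree ≤ 2 ^ n := by
  rw [iterNum_eq hd]; exact (natDegree_liftMap_iterate p q n).1

/-- The coefficient of `x ^ (2 ^ n)` in `p_n` is `P_n(1, 0)`. -/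
theorem coeff_iterNum {p q : K[X]} (hd : deg p q = 2) (n : ℕ) :
    algebraMap K R ((iterNum p q n).coeff (2 ^ n)) = ((liftMap p q)^[n] ((1 : R), (0 : R))).1 := by
  have h1 := congrArg Prod.fst (natDegree_liftMap_iterate p q n).2.2
  have h2 := congrArg Prod.fst (map_liftMap_iterate (Algebra.ofId K R) p q n (1, 0))
  rw [iterNum_eq hd]
  simp only at h1
  rw [h1]
  simpa [Algebra.ofId_apply] using h2

end Forms

section Field

variable {K : Type*} [Field K] {L : Type*} [Field L] [Algebra K L]

theorem form_eq_mul_aeval {f : K[X]} (hf : f.natDegree ≤ 2) {v : L × L} (hv : v.2 ≠ 0) :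
    form f v = v.2 ^ 2 * aeval (v.1 / v.2) f := by
  rw [aeval_eq_form hf, form, form]
  field_simp

theorem coeff_two_ne_zero {p q : K[X]} (hd : deg p q = 2) : p.coeff 2 ≠ 0 ∨ q.coeff 2 ≠ 0 := by
  unfold deg at hd
  rcases max_choice p.natDegree q.natDegree with h | h
  · left
    have h2 : p.natDegree = 2 := by omega
    rw [← h2]
    exact leadingCoeff_ne_zero.2 (by rintro rfl; simp at h2)
  · right
    have h2 : q.natDegree = 2 := by omega
    rw [← h2]
    exact leadingCoeff_ne_zero.2 (by rintro rfl; simp at h2)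

theorem aeval_ne_zero_or {p q : K[X]} (hpq : IsCoprime p q) (x : L) :
    aeval x p ≠ 0 ∨ aeval x q ≠ 0 := by
  by_contra! h
  obtain ⟨a, b, hab⟩ := hpq
  simpa [h.1, h.2] using congrArg (aeval x) hab

theorem liftMap_ne_zero {p q : K[X]} (hpq : IsCoprime p q) (hd : deg p q = 2) {v : L × L}
    (hv : v ≠ 0) : liftMap p q v ≠ 0 := by
  obtain ⟨hp, hq⟩ := natDegree_le_of_deg hd
  intro h
  obtain ⟨h1, h2⟩ := Prod.ext_iff.1 h
  simp only [liftMap, Prod.fst_zero, Prod.snd_zero] at h1 h2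
  by_cases hy : v.2 = 0
  · have hx : v.1 ≠ 0 := fun hx => hv (Prod.ext hx hy)
    simp only [form, hy] at h1 h2
    rcases coeff_two_ne_zero hd with h' | h'
    · simp [hx, h'] at h1
    · simp [hx, h'] at h2
  · rw [form_eq_mul_aeval hp hy] at h1
    rw [form_eq_mul_aeval hq hy] at h2
    rcases aeval_ne_zero_or hpq (v.1 / v.2) with h' | h'
    · simp [hy, h'] at h1
    · simp [hy, h'] at h2

theorem liftMap_iterate_ne_zero {p q : K[X]} (hpq : IsCoprime p q) (hd : deg p q = 2) {v : L × L}
    (hv : v ≠ 0) (n : ℕ) : (liftMap p q)^[n] v ≠ 0 := by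
  induction n with
  | zero => exact hv
  | succ n ih => rw [Function.iterate_succ_apply']; exact liftMap_ne_zero hpq hd ih

open Classical in
/-- The point of `ℙ¹(L) = L ∪ {∞}` with homogeneous coordinates `v`. -/
noncomputable def toPoint (v : L × L) : OnePoint L :=
  if v.2 = 0 then ∞ else ((v.1 / v.2 : L) : OnePoint L)

theorem toPoint_of_eq {v : L × L} (h : v.2 = 0) : toPoint v = ∞ := if_pos h

theorem toPoint_of_ne {v : L × L} (h : v.2 ≠ 0) : toPoint v = ((v.1 / v.2 : L) : OnePoint L) :=
  if_neg h

theorem ratMap_infty {p q : K[X]} (hd : deg p q = 2) :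
    ratMap p q L ∞ = toPoint (liftMap p q ((1 : L), (0 : L))) := by
  by_cases h : q.coeff 2 = 0
  · rw [toPoint_of_eq (by simp [liftMap, form, h])]
    simp [ratMap, hd, h]
  · rw [toPoint_of_ne (by simp [liftMap, form, h])]
    simp [ratMap, hd, h, liftMap, form]

theorem ratMap_coe {p q : K[X]} (hd : deg p q = 2) (x : L) :
    ratMap p q L (x : OnePoint L) = toPoint (liftMap p q (x, (1 : L))) := by
  obtain ⟨hp, hq⟩ := natDegree_le_of_deg hd
  have e : liftMap p q (x, (1 : L)) = (aeval x p, aeval x q) := by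
    rw [liftMap, aeval_eq_form hp, aeval_eq_form hq]
  rw [e]
  by_cases h : aeval x q = 0
  · rw [toPoint_of_eq h]; simp [ratMap, h]
  · rw [toPoint_of_ne h]; simp [ratMap, h]

theorem toPoint_smul {c : L} (hc : c ≠ 0) (v : L × L) : toPoint (c • v) = toPoint v := by
  by_cases h : v.2 = 0
  · rw [toPoint_of_eq h, toPoint_of_eq (by simp [h])]
  · rw [toPoint_of_ne h, toPoint_of_ne (by simp [h, hc])]
    simp [mul_div_mul_left _ _ hc]

theorem ratMap_toPoint {p q : K[X]} (hd : deg p q = 2) {v : L × L}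
    (hv : v ≠ 0) : ratMap p q L (toPoint v) = toPoint (liftMap p q v) := by
  have hsmul : ∀ (c : L) (w : L × L), liftMap p q (c • w) = c ^ 2 • liftMap p q w := fun c w => by
    simpa using liftMap_iterate_smul p q 1 c w
  by_cases hy : v.2 = 0
  · have hx : v.1 ≠ 0 := fun hx => hv (Prod.ext hx hy)
    have e : v = v.1 • ((1 : L), (0 : L)) := by ext <;> simp [hy]
    rw [toPoint_of_eq hy, ratMap_infty hd, e, hsmul, toPoint_smul (pow_ne_zero 2 hx)]
  · have e : v = v.2 • (v.1 / v.2, (1 : L)) := by ext <;> simp [mul_div_cancel₀ _ hy]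
    rw [toPoint_of_ne hy, ratMap_coe hd]
    conv_rhs => rw [e, hsmul, toPoint_smul (pow_ne_zero 2 hy)]

theorem ratMap_iterate_infty {p q : K[X]} (hpq : IsCoprime p q) (hd : deg p q = 2) (n : ℕ) :
    (ratMap p q L)^[n] ∞ = toPoint ((liftMap p q)^[n] ((1 : L), (0 : L))) := by
  induction n with
  | zero => simp [toPoint]
  | succ n ih =>
    rw [Function.iterate_succ_apply', Function.iterate_succ_apply', ih,
      ratMap_toPoint hd (liftMap_iterate_ne_zero hpq hd (by simp) n)]

/-- `φⁿ(∞) ≠ 0` says that `p_n` has the full degree `2 ^ n`. -/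
theorem coeff_iterNum_ne_zero {p q : K[X]} (hpq : IsCoprime p q) (hd : deg p q = 2) {n : ℕ}
    (h : (ratMap p q L)^[n] ∞ ≠ ((0 : L) : OnePoint L)) : (iterNum p q n).coeff (2 ^ n) ≠ 0 := by
  intro h0
  apply h
  have h1 := coeff_iterNum (R := L) hd n
  rw [h0, map_zero] at h1
  have h2 := liftMap_iterate_ne_zero (L := L) hpq hd (v := (1, 0)) (by simp) n
  rw [ratMap_iterate_infty hpq hd, toPoint, if_neg, ← h1]
  · simp
  · exact fun h3 => h2 (Prod.ext h1.symm h3)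

theorem natDegree_iterNum {p q : K[X]} (hd : deg p q = 2) {n : ℕ}
    (h : (iterNum p q n).coeff (2 ^ n) ≠ 0) : (iterNum p q n).natDegree = 2 ^ n :=
  natDegree_eq_of_le_of_coeff_ne_zero (natDegree_iterNum_le hd n) h

theorem ne_zero_of_coeff_ne_zero {f : K[X]} {m : ℕ} (h : f.coeff m ≠ 0) : f ≠ 0 := by
  rintro rfl; simp at h

theorem liftMap_iterate_fst_of_snd_ne_zero {p q : K[X]} (hd : deg p q = 2) (n : ℕ) {v : L × L}
    (hv : v.2 ≠ 0) :
    ((liftMap p q)^[n] v).1 = v.2 ^ 2 ^ n * aeval (v.1 / v.2) (iterNum p q n) := by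
  have : v = v.2 • (v.1 / v.2, (1 : L)) := by
    ext <;> simp [mul_div_cancel₀ _ hv]
  conv_lhs => rw [this, liftMap_iterate_smul]
  rw [aeval_iterNum hd]
  rfl

theorem aeval_iterNum_succ {p q : K[X]} (hd : deg p q = 2) (n : ℕ) (x : L) :
    aeval x (iterNum p q (n + 1)) = ((liftMap p q)^[n] (aeval x p, aeval x q)).1 := by
  obtain ⟨hp, hq⟩ := natDegree_le_of_deg hd
  rw [aeval_iterNum hd, Function.iterate_succ_apply, liftMap, aeval_eq_form hp, aeval_eq_form hq]

theorem aeval_iterNum_succ_of_ne {p q : K[X]} (hd : deg p q = 2) (n : ℕ) {x : L}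
    (hx : aeval x q ≠ 0) :
    aeval x (iterNum p q (n + 1)) =
      aeval x q ^ 2 ^ n * aeval (aeval x p / aeval x q) (iterNum p q n) := by
  rw [aeval_iterNum_succ hd, liftMap_iterate_fst_of_snd_ne_zero hd n hx]

/-- The roots of `p_{n+1}` are the preimages under `φ` of the roots of `p_n`. -/
theorem aeval_iterNum_succ_eq_zero_iff {p q : K[X]} (hpq : IsCoprime p q) (hd : deg p q = 2)
    {n : ℕ} (h : (iterNum p q n).coeff (2 ^ n) ≠ 0) (β : L) :
    aeval β (iterNum p q (n + 1)) = 0 ↔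
      ∃ α, aeval α (iterNum p q n) = 0 ∧ aeval β p = α * aeval β q := by
  by_cases hq : aeval β q = 0
  · have hp : aeval β p ≠ 0 := (aeval_ne_zero_or hpq β).resolve_right (by simpa using hq)
    simp only [hq, mul_zero, hp, and_false, exists_false, iff_false]
    rw [aeval_iterNum_succ hd, hq]
    have : (aeval β p, (0 : L)) = aeval β p • ((1 : L), (0 : L)) := by simp
    rw [this, liftMap_iterate_smul, Prod.smul_fst, ← coeff_iterNum hd, smul_eq_mul]
    simp [hp, h]
  · rw [aeval_iterNum_succ_of_ne hd n hq, mul_eq_zero]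
    constructor
    · rintro (h' | h')
      · simp [hq] at h'
      · exact ⟨_, h', by field_simp⟩
    · rintro ⟨α, hα, e⟩
      right
      rwa [e, mul_div_cancel_right₀ _ hq]

/-- If `φ^{n+1}(∞) ≠ 0`, then `p - α q` is a genuine quadratic for each root `α` of `p_n`. -/
theorem coeff_two_sub_ne_zero {p q : K[X]} (hd : deg p q = 2) {n : ℕ}
    (h : (iterNum p q (n + 1)).coeff (2 ^ (n + 1)) ≠ 0) {α : L}
    (hα : aeval α (iterNum p q n) = 0) :
    algebraMap K L (p.coeff 2) - α * algebraMap K L (q.coeff 2) ≠ 0 := by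
  intro h0
  apply h
  apply (algebraMap K L).injective
  rw [coeff_iterNum hd, Function.iterate_succ_apply, map_zero]
  have : liftMap p q ((1 : L), (0 : L)) = algebraMap K L (q.coeff 2) • (α, (1 : L)) := by
    ext
    · simp [liftMap, form]
      rw [Algebra.smul_def]; linear_combination h0
    · simp [liftMap, form]
      rw [Algebra.smul_def, mul_one]
  rw [this, liftMap_iterate_smul, Prod.smul_fst, ← aeval_iterNum hd, hα, smul_zero]

/-- The discriminant of the quadratic form `P - t Q`. -/
def fiberDisc (p q : K[X]) (t : L) : L :=
  (algebraMap K L (p.coeff 1) - t * algebraMap K L (q.coeff 1)) ^ 2 -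
    4 * (algebraMap K L (p.coeff 2) - t * algebraMap K L (q.coeff 2)) *
      (algebraMap K L (p.coeff 0) - t * algebraMap K L (q.coeff 0))

/-- The value at `x` of the derivative of the quadratic `p - t q`. -/
def fiberDeriv (p q : K[X]) (t x : L) : L :=
  2 * (algebraMap K L (p.coeff 2) - t * algebraMap K L (q.coeff 2)) * x +
    (algebraMap K L (p.coeff 1) - t * algebraMap K L (q.coeff 1))

theorem fiberDeriv_sq {p q : K[X]} (hd : deg p q = 2) {t x : L}
    (h : aeval x p = t * aeval x q) : fiberDeriv p q t x ^ 2 = fiberDisc p q t := by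
  obtain ⟨hp, hq⟩ := natDegree_le_of_deg hd
  rw [aeval_eq_form hp, aeval_eq_form hq] at h
  simp only [form] at h
  unfold fiberDeriv fiberDisc
  linear_combination
    4 * (algebraMap K L (p.coeff 2) - t * algebraMap K L (q.coeff 2)) * h

end Field

end RatDyn

/-! ### The tower of fields as a tower of multiquadratic extensions -/

namespace RatDyn

section Galois

open IntermediateField

/-- A nonzero quadratic has at most two roots, so an automorphism fixing its coefficients acts on
the roots with square one. -/
theorem apply_apply_eq_of_quadratic {L : Type*} [Field L] (τ : L ≃+* L) {A B C β : L}
    (hA : τ A = A) (hB : τ B = B) (hC : τ C = C) (hne : A ≠ 0 ∨ B ≠ 0 ∨ C ≠ 0)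
    (hβ : A * β ^ 2 + B * β + C = 0) : τ (τ β) = β := by
  have step : ∀ x, A * x ^ 2 + B * x + C = 0 → A * (τ x) ^ 2 + B * τ x + C = 0 := by
    intro x hx
    have := congrArg τ hx
    simpa [hA, hB, hC] using this
  have h1 := step β hβ
  have h2 := step _ h1
  by_cases e1 : τ β = β
  · rw [e1, e1]
  by_contra e3
  have e2 : τ (τ β) ≠ τ β := fun e => e1 (τ.injective e)
  have f1 : A * (τ β + β) + B = 0 := by
    apply mul_left_cancel₀ (sub_ne_zero.2 e1); linear_combination h1 - hβ
  have f2 : A * (τ (τ β) + τ β) + B = 0 := by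
    apply mul_left_cancel₀ (sub_ne_zero.2 e2); linear_combination h2 - h1
  have hA0 : A = 0 := by
    apply mul_left_cancel₀ (sub_ne_zero.2 e3); linear_combination f2 - f1
  have hB0 : B = 0 := by simpa [hA0] using f1
  have hC0 : C = 0 := by simpa [hA0, hB0] using hβ
  simp [hA0, hB0, hC0] at hne

variable {K : Type*} [Field K] {L : Type*} [Field L] [Algebra K L]

theorem fiber_quadratic {p q : K[X]} (hd : deg p q = 2) {t x : L}
    (h : aeval x p = t * aeval x q) :
    (algebraMap K L (p.coeff 2) - t * algebraMap K L (q.coeff 2)) * x ^ 2 +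
      (algebraMap K L (p.coeff 1) - t * algebraMap K L (q.coeff 1)) * x +
      (algebraMap K L (p.coeff 0) - t * algebraMap K L (q.coeff 0)) = 0 := by
  obtain ⟨hp, hq⟩ := natDegree_le_of_deg hd
  rw [aeval_eq_form hp, aeval_eq_form hq] at h
  simp only [form] at h
  linear_combination h

theorem quadResultant_ne_zero_aux {p q : K[X]} (hpq : IsCoprime p q) (hp : p.natDegree ≤ 2)
    (hq : q.natDegree ≤ 2) (h2 : p.coeff 2 ≠ 0) :
    (p.coeff 2 * q.coeff 0 - p.coeff 0 * q.coeff 2) ^ 2 -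
      (p.coeff 2 * q.coeff 1 - p.coeff 1 * q.coeff 2) *
        (p.coeff 1 * q.coeff 0 - p.coeff 0 * q.coeff 1) ≠ 0 := by
  intro h
  -- `p₂ q - q₂ p = u x + v` is linear, with root `-v / u` if `u ≠ 0`
  set u := p.coeff 2 * q.coeff 1 - p.coeff 1 * q.coeff 2 with hu
  set v := p.coeff 2 * q.coeff 0 - p.coeff 0 * q.coeff 2 with hv
  have hlin : ∀ x : K, p.coeff 2 * aeval x q = q.coeff 2 * aeval x p + u * x + v := by
    intro x
    rw [aeval_eq_form hp, aeval_eq_form hq]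
    simp only [form, Algebra.algebraMap_self, RingHom.id_apply]
    rw [hu, hv]; ring
  by_cases hu0 : u = 0
  · have hv0 : v = 0 := by simpa [hu0] using h
    have hprop : C (p.coeff 2) * q = C (q.coeff 2) * p := by
      rw [eq_of_natDegree_le_two hp, eq_of_natDegree_le_two hq]
      have e1 := congrArg (C : K → K[X]) (hu ▸ hu0)
      have e0 := congrArg (C : K → K[X]) (hv ▸ hv0)
      simp only [C_sub, C_mul, C_0] at e0 e1
      simp
      linear_combination e0 + e1 * X
    obtain ⟨a, b, hab⟩ := hpq
    have hunit : IsUnit p := by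
      refine IsUnit.of_mul_eq_one (a + b * C ((p.coeff 2)⁻¹ * q.coeff 2)) ?_
      have : q = C ((p.coeff 2)⁻¹ * q.coeff 2) * p := by
        rw [C_mul, mul_assoc, ← hprop, ← mul_assoc, ← C_mul, inv_mul_cancel₀ h2]
        simp
      conv_rhs => rw [← hab, this]
      ring
    have hdeg := natDegree_eq_zero_of_isUnit hunit
    exact h2 (coeff_eq_zero_of_natDegree_lt (by omega))
  · have hpx : aeval (-v / u) p = 0 := by
      rw [aeval_eq_form hp]
      simp only [form, Algebra.algebraMap_self, RingHom.id_apply]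
      field_simp
      rw [hu, hv] at h ⊢
      linear_combination p.coeff 2 * h
    have hqx : aeval (-v / u) q = 0 := by
      have := hlin (-v / u)
      rw [hpx, mul_div_cancel₀ _ hu0] at this
      simpa [h2] using this
    rcases aeval_ne_zero_or hpq (-v / u) with h' | h'
    · exact h' hpx
    · exact h' hqx

/-- The resultant of the forms `P` and `Q` does not vanish. -/
theorem quadResultant_ne_zero {p q : K[X]} (hpq : IsCoprime p q) (hd : deg p q = 2) :
    (p.coeff 2 * q.coeff 0 - p.coeff 0 * q.coeff 2) ^ 2 -
      (p.coeff 2 * q.coeff 1 - p.coeff 1 * q.coeff 2) *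
        (p.coeff 1 * q.coeff 0 - p.coeff 0 * q.coeff 1) ≠ 0 := by
  obtain ⟨hp, hq⟩ := natDegree_le_of_deg hd
  rcases coeff_two_ne_zero hd with h2 | h2
  · exact quadResultant_ne_zero_aux hpq hp hq h2
  · convert quadResultant_ne_zero_aux hpq.symm hq hp h2 using 1
    ring

/-- No nontrivial combination of the forms `P` and `Q` vanishes. -/
theorem pencil_ne_zero {p q : K[X]} (hpq : IsCoprime p q) (hd : deg p q = 2) {x y : L}
    (hxy : x ≠ 0 ∨ y ≠ 0) :
    x * algebraMap K L (p.coeff 2) - y * algebraMap K L (q.coeff 2) ≠ 0 ∨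
      x * algebraMap K L (p.coeff 1) - y * algebraMap K L (q.coeff 1) ≠ 0 ∨
      x * algebraMap K L (p.coeff 0) - y * algebraMap K L (q.coeff 0) ≠ 0 := by
  by_contra! h
  obtain ⟨h2, h1, h0⟩ := h
  have hres := (map_ne_zero (algebraMap K L)).2 (quadResultant_ne_zero hpq hd)
  simp only [map_sub, map_mul, map_pow] at hres
  generalize algebraMap K L (p.coeff 2) = p2 at *
  generalize algebraMap K L (p.coeff 1) = p1 at *
  generalize algebraMap K L (p.coeff 0) = p0 at *
  generalize algebraMap K L (q.coeff 2) = q2 at *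
  generalize algebraMap K L (q.coeff 1) = q1 at *
  generalize algebraMap K L (q.coeff 0) = q0 at *
  have hminor : ∀ a b c d : L, x * a - y * b = 0 → x * c - y * d = 0 → a * d - c * b = 0 := by
    intro a b c d e e'
    rcases hxy with hx | hy
    · apply mul_left_cancel₀ hx; linear_combination d * e - b * e'
    · apply mul_left_cancel₀ hy; linear_combination c * e - a * e'
  apply hres
  linear_combination (p2 * q0 - p0 * q2) * hminor _ _ _ _ h2 h0 -
    (p1 * q0 - p0 * q1) * hminor _ _ _ _ h2 h1

/-- Every Galois automorphism acts on the roots of `p_n` with order a power of two. -/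
theorem exists_pow_two_pow_apply_eq {p q : K[X]} (hpq : IsCoprime p q) (hd : deg p q = 2)
    (σ : L ≃ₐ[K] L) (n : ℕ) {β : L} (hβ : aeval β (iterNum p q n) = 0) :
    ∃ k, (σ ^ 2 ^ k) β = β := by
  induction n generalizing β with
  | zero =>
    refine ⟨0, ?_⟩
    have : β = 0 := by simpa [iterNum_zero] using hβ
    simp [this]
  | succ n ih =>
    obtain ⟨hp, hq⟩ := natDegree_le_of_deg hd
    -- it is enough to fix the point `(y : x)` below `β`
    suffices h : ∃ k, ∃ x y : L, (x ≠ 0 ∨ y ≠ 0) ∧ (σ ^ 2 ^ k) x = x ∧ (σ ^ 2 ^ k) y = y ∧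
        x * aeval β p = y * aeval β q by
      obtain ⟨k, x, y, hxy, hx, hy, h⟩ := h
      refine ⟨k + 1, ?_⟩
      rw [pow_succ, pow_mul, sq, AlgEquiv.mul_apply]
      set τ := σ ^ 2 ^ k
      rw [aeval_eq_form hp, aeval_eq_form hq] at h
      simp only [form] at h
      refine apply_apply_eq_of_quadratic τ.toRingEquiv
        (A := x * algebraMap K L (p.coeff 2) - y * algebraMap K L (q.coeff 2))
        (B := x * algebraMap K L (p.coeff 1) - y * algebraMap K L (q.coeff 1))
        (C := x * algebraMap K L (p.coeff 0) - y * algebraMap K L (q.coeff 0))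
        (by simp [hx, hy]) (by simp [hx, hy]) (by simp [hx, hy]) (pencil_ne_zero hpq hd hxy)
        (by linear_combination h)
    by_cases h : aeval β q = 0
    · exact ⟨0, 0, 1, by simp, by simp, by simp, by simp [h]⟩
    · rw [aeval_iterNum_succ_of_ne hd n h, mul_eq_zero] at hβ
      obtain ⟨k, hk⟩ := ih (hβ.resolve_left (by simp [h]))
      exact ⟨k, 1, _, by simp, by simp, hk, by field_simp⟩

theorem aeval_algEquiv (σ : L ≃ₐ[K] L) (f : K[X]) (x : L) :
    aeval (σ x) f = σ (aeval x f) := aeval_algHom_apply σ.toAlgHom x f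

theorem algEquiv_mem_iterField {p q : K[X]} (σ : AlgebraicClosure K ≃ₐ[K] AlgebraicClosure K)
    (n : ℕ) {y : AlgebraicClosure K} (hy : y ∈ iterField p q n) : σ y ∈ iterField p q n := by
  have h : (iterField p q n).map σ.toAlgHom ≤ iterField p q n := by
    unfold iterField
    rw [adjoin_map]
    refine adjoin.mono _ _ _ ?_
    rintro _ ⟨x, hx, rfl⟩
    rw [mem_rootSet] at hx ⊢
    exact ⟨hx.1, by
      change aeval (σ x) _ = 0
      rw [aeval_algEquiv, hx.2, map_zero]⟩
  exact h ⟨y, hy, rfl⟩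

theorem fiberDisc_algEquiv (p q : K[X]) (σ : L ≃ₐ[K] L) (t : L) :
    fiberDisc p q (σ t) = σ (fiberDisc p q t) := by
  simp [fiberDisc, map_ofNat σ 4]

/-- A chosen square root of the discriminant of `P - t Q`. -/
noncomputable def sqrtDisc (p q : K[X]) (t : AlgebraicClosure K) : AlgebraicClosure K :=
  Classical.choose (IsAlgClosed.exists_pow_nat_eq (fiberDisc p q t) (n := 2) two_pos)

theorem sqrtDisc_sq (p q : K[X]) (t : AlgebraicClosure K) :
    sqrtDisc p q t ^ 2 = fiberDisc p q t :=
  Classical.choose_spec (IsAlgClosed.exists_pow_nat_eq (fiberDisc p q t) (n := 2) two_pos)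

variable [CharZero K]

/-- The fiber of `φ` over a point where `P - t Q` has degree two, by the quadratic formula. -/
theorem exists_mem_fiber {p q : K[X]} (hd : deg p q = 2) {t : AlgebraicClosure K}
    (h : algebraMap K (AlgebraicClosure K) (p.coeff 2) -
      t * algebraMap K (AlgebraicClosure K) (q.coeff 2) ≠ 0) :
    ∃ x, aeval x p = t * aeval x q ∧ fiberDeriv p q t x = sqrtDisc p q t := by
  obtain ⟨hp, hq⟩ := natDegree_le_of_deg hd
  have hs := sqrtDisc_sq p q t
  have e : fiberDeriv p q t ((-(algebraMap K (AlgebraicClosure K) (p.coeff 1) -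
      t * algebraMap K (AlgebraicClosure K) (q.coeff 1)) + sqrtDisc p q t) /
      (2 * (algebraMap K (AlgebraicClosure K) (p.coeff 2) -
        t * algebraMap K (AlgebraicClosure K) (q.coeff 2)))) = sqrtDisc p q t := by
    unfold fiberDeriv
    rw [mul_div_cancel₀ _ (mul_ne_zero two_ne_zero h)]
    ring
  refine ⟨_, ?_, e⟩
  generalize (-(algebraMap K (AlgebraicClosure K) (p.coeff 1) -
      t * algebraMap K (AlgebraicClosure K) (q.coeff 1)) + sqrtDisc p q t) /
      (2 * (algebraMap K (AlgebraicClosure K) (p.coeff 2) -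
        t * algebraMap K (AlgebraicClosure K) (q.coeff 2))) = x at e ⊢
  rw [← e] at hs
  unfold fiberDeriv fiberDisc at hs
  rw [aeval_eq_form hp, aeval_eq_form hq]
  simp only [form]
  have h4 : (4 : AlgebraicClosure K) ≠ 0 := by
    have : CharZero (AlgebraicClosure K) := charZero_of_injective_algebraMap
      (algebraMap K (AlgebraicClosure K)).injective
    norm_num
  apply mul_left_cancel₀ (mul_ne_zero h4 h)
  linear_combination hs

/-- `K_{n+1}` arises from `K_n` by adjoining the square roots of the discriminants of the
quadratics `p - α q`, for `α` a root of `p_n`. -/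
theorem iterField_succ {p q : K[X]} (hpq : IsCoprime p q) (hd : deg p q = 2) {n : ℕ}
    (h : (iterNum p q n).coeff (2 ^ n) ≠ 0)
    (h' : (iterNum p q (n + 1)).coeff (2 ^ (n + 1)) ≠ 0) :
    iterField p q (n + 1) = iterField p q n ⊔
      adjoin K (sqrtDisc p q '' (iterNum p q n).rootSet (AlgebraicClosure K)) := by
  have hn := ne_zero_of_coeff_ne_zero h
  have hn' := ne_zero_of_coeff_ne_zero h'
  have hK : ∀ (E : IntermediateField K (AlgebraicClosure K)) (c : K),
    algebraMap K (AlgebraicClosure K) c ∈ E := fun E c => E.algebraMap_mem c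
  apply le_antisymm
  · refine adjoin_le_iff.2 fun β hβ => ?_
    set E := iterField p q n ⊔
      adjoin K (sqrtDisc p q '' (iterNum p q n).rootSet (AlgebraicClosure K))
    rw [mem_rootSet, aeval_iterNum_succ_eq_zero_iff hpq hd h] at hβ
    obtain ⟨-, α, hα, e⟩ := hβ
    have hA := coeff_two_sub_ne_zero hd h' hα
    have hαm : α ∈ (iterNum p q n).rootSet (AlgebraicClosure K) := mem_rootSet.2 ⟨hn, hα⟩
    have hαE : α ∈ E := (le_sup_left : iterField p q n ≤ E) (subset_adjoin K _ hαm)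
    have hsE : sqrtDisc p q α ∈ E := (le_sup_right : adjoin K _ ≤ E)
      (subset_adjoin K _ ⟨α, hαm, rfl⟩)
    have hder : fiberDeriv p q α β ∈ E := by
      have := (fiberDeriv_sq hd e).trans (sqrtDisc_sq p q α).symm
      rcases sq_eq_sq_iff_eq_or_eq_neg.1 this with e | e
      · rw [e]; exact hsE
      · rw [e]; exact neg_mem hsE
    have : β = (fiberDeriv p q α β - (algebraMap K (AlgebraicClosure K) (p.coeff 1) -
        α * algebraMap K (AlgebraicClosure K) (q.coeff 1))) /
        (2 * (algebraMap K (AlgebraicClosure K) (p.coeff 2) -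
          α * algebraMap K (AlgebraicClosure K) (q.coeff 2))) := by
      rw [eq_div_iff (mul_ne_zero two_ne_zero hA)]
      unfold fiberDeriv; ring
    rw [this]
    exact div_mem (sub_mem hder (sub_mem (hK _ _) (mul_mem hαE (hK _ _))))
      (mul_mem (ofNat_mem _ 2) (sub_mem (hK _ _) (mul_mem hαE (hK _ _))))
  · have key : ∀ α ∈ (iterNum p q n).rootSet (AlgebraicClosure K),
        α ∈ iterField p q (n + 1) ∧ sqrtDisc p q α ∈ iterField p q (n + 1) := by
      intro α hα
      have hα0 := (mem_rootSet.1 hα).2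
      obtain ⟨β, hβ, hs⟩ := exists_mem_fiber hd (coeff_two_sub_ne_zero hd h' hα0)
      have hβm : β ∈ iterField p q (n + 1) := subset_adjoin K _
        (mem_rootSet.2 ⟨hn', (aeval_iterNum_succ_eq_zero_iff hpq hd h β).2 ⟨α, hα0, hβ⟩⟩)
      have hαm : α ∈ iterField p q (n + 1) := by
        have hq0 : aeval β q ≠ 0 := by
          intro hq0
          rcases aeval_ne_zero_or hpq β with h'' | h''
          · exact h'' (by rw [hβ, hq0, mul_zero])
          · exact h'' hq0
        rw [eq_div_of_mul_eq hq0 hβ.symm]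
        have hev : ∀ f : K[X], aeval β f ∈ iterField p q (n + 1) := fun f =>
          (aeval_mem_adjoin_singleton K β : aeval β f ∈ Algebra.adjoin K {β}) |> fun hm =>
            (Algebra.adjoin_le (S := (iterField p q (n + 1)).toSubalgebra)
              (Set.singleton_subset_iff.2 hβm)) hm
        exact div_mem (hev p) (hev q)
      refine ⟨hαm, ?_⟩
      rw [← hs]
      unfold fiberDeriv
      exact add_mem (mul_mem (mul_mem (ofNat_mem _ 2) (sub_mem (hK _ _) (mul_mem hαm (hK _ _))))
        hβm) (sub_mem (hK _ _) (mul_mem hαm (hK _ _)))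
    refine sup_le (adjoin_le_iff.2 fun α hα => (key α hα).1) (adjoin_le_iff.2 ?_)
    rintro _ ⟨α, hα, rfl⟩
    exact (key α hα).2

theorem card_rootSet_iterNum {p q : K[X]} (hd : deg p q = 2) {n : ℕ}
    (h : (iterNum p q n).coeff (2 ^ n) ≠ 0) (hirr : Irreducible (iterNum p q n)) :
    Fintype.card ((iterNum p q n).rootSet (AlgebraicClosure K)) = 2 ^ n := by
  rw [card_rootSet_eq_natDegree hirr.separable (IsAlgClosed.splits _), natDegree_iterNum hd h]

/-- The degree of `K_{n+1}` over `K_n` is maximal if and only if the product of all the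
discriminants of `p - α q` over the roots `α` of `p_n` is not a square in `K_n`: by Galois
symmetry, if any subproduct is a square, then so is the full product. -/
theorem relfinrank_iterField_succ {p q : K[X]} (hpq : IsCoprime p q) (hd : deg p q = 2) {n : ℕ}
    (h : (iterNum p q n).coeff (2 ^ n) ≠ 0)
    (h' : (iterNum p q (n + 1)).coeff (2 ^ (n + 1)) ≠ 0)
    (hirr : Irreducible (iterNum p q n)) :
    (iterField p q n).relfinrank (iterField p q (n + 1)) = 2 ^ 2 ^ n ↔
      ¬ ∃ y ∈ iterField p q n,
        y ^ 2 = ∏ α : (iterNum p q n).rootSet (AlgebraicClosure K),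
          fiberDisc p q (α : AlgebraicClosure K) := by
  classical
  set A := (iterNum p q n).rootSet (AlgebraicClosure K) with hA
  set F := iterField p q n
  have hcard : (Finset.univ : Finset A).card = 2 ^ n := by
    rw [Finset.card_univ, card_rootSet_iterNum hd h hirr]
  have hAF : ∀ α : A, (α : AlgebraicClosure K) ∈ F := fun α => subset_adjoin K _ α.2
  have ha : ∀ α : A, fiberDisc p q (α : AlgebraicClosure K) ∈ F := fun α => by
    unfold fiberDisc
    have hK : ∀ c : K, algebraMap K (AlgebraicClosure K) c ∈ F := fun c => F.algebraMap_mem c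
    exact sub_mem (pow_mem (sub_mem (hK _) (mul_mem (hAF α) (hK _))) 2)
      (mul_mem (mul_mem (ofNat_mem _ 4) (sub_mem (hK _) (mul_mem (hAF α) (hK _))))
        (sub_mem (hK _) (mul_mem (hAF α) (hK _))))
  have hs : ∀ α : A, sqrtDisc p q (α : AlgebraicClosure K) ^ 2 = fiberDisc p q _ :=
    fun α => sqrtDisc_sq p q α
  have hfield : iterField p q (n + 1) = F ⊔ adjoin K
      ((fun α : A => sqrtDisc p q (α : AlgebraicClosure K)) '' (Finset.univ : Finset A)) := by
    rw [iterField_succ hpq hd h h']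
    congr 2
    ext x
    simp [hA]
  rw [hfield, ← hcard]
  constructor
  · intro hmax hsq
    have hne : (Finset.univ : Finset A).Nonempty := by
      rw [← Finset.card_pos, hcard]; positivity
    exact (relfinrank_sup_adjoin_sqrts_lt F _ _ ha hs Finset.univ hne hsq).ne hmax
  · intro hsq
    refine relfinrank_sup_adjoin_sqrts_eq F _ _ ha hs _ fun T _ hT hTsq => hsq ?_
    have hσA : ∀ (σ : AlgebraicClosure K ≃ₐ[K] AlgebraicClosure K) (α : A),
        σ (α : AlgebraicClosure K) ∈ A := fun σ α => by
      have := mem_rootSet.1 α.2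
      exact mem_rootSet.2 ⟨this.1, by rw [aeval_algEquiv, this.2, map_zero]⟩
    have htrans : ∀ α β : A, ∃ σ : AlgebraicClosure K ≃ₐ[K] AlgebraicClosure K, σ α = (β : _) := by
      intro α β
      refine minpoly.exists_algEquiv_of_root (Algebra.IsAlgebraic.isAlgebraic _) ?_
      have hα := (mem_rootSet.1 α.2).2
      have hβ := (mem_rootSet.1 β.2).2
      rw [← minpoly.eq_of_irreducible hirr hβ]
      simp [hα]
    -- a vanishing discriminant makes the full product zero
    by_cases h0 : ∃ α : A, fiberDisc p q (α : AlgebraicClosure K) = 0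
    · obtain ⟨α, hα⟩ := h0
      exact ⟨0, zero_mem _, by rw [Finset.prod_eq_zero (Finset.mem_univ α) hα]; simp⟩
    push Not at h0
    let act : (AlgebraicClosure K ≃ₐ[K] AlgebraicClosure K) →* Equiv.Perm A :=
      { toFun := fun σ =>
          { toFun := fun α => ⟨σ α, hσA σ α⟩
            invFun := fun α => ⟨σ⁻¹ α, hσA σ⁻¹ α⟩
            left_inv := fun α => Subtype.ext (by simp)
            right_inv := fun α => Subtype.ext (by simp) }
        map_one' := by ext; rfl
        map_mul' := fun σ τ => by ext; rfl }
    have hact : ∀ σ (α : A), ((act σ α : A) : AlgebraicClosure K) = σ α := fun _ _ => rfl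
    refine Finset.univ_mem_of_isPGroup_two act.range ?_ ?_
      {S | ∃ y ∈ F, y ^ 2 = ∏ α ∈ S, fiberDisc p q (α : AlgebraicClosure K)} ?_ ?_ ?_ hTsq hT
    · rintro ⟨_, σ, rfl⟩
      have hk : ∀ α : A, ∃ k, (σ ^ 2 ^ k) (α : AlgebraicClosure K) = α := fun α =>
        exists_pow_two_pow_apply_eq hpq hd σ n (mem_rootSet.1 α.2).2
      choose k hk using hk
      refine ⟨Finset.univ.sup k, Subtype.ext ?_⟩
      change (act σ) ^ _ = 1
      rw [← map_pow]
      ext α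
      rw [hact]
      obtain ⟨d, hd⟩ := Nat.exists_eq_add_of_le (Finset.le_sup (Finset.mem_univ α) (f := k))
      rw [hd, pow_add, pow_mul]
      generalize 2 ^ d = m
      have := hk α
      induction m with
      | zero => simp
      | succ m ih => rw [pow_succ, AlgEquiv.mul_apply, this, ih]
    · intro α β
      obtain ⟨σ, hσ⟩ := htrans α β
      exact ⟨act σ, ⟨σ, rfl⟩, Subtype.ext hσ⟩
    · exact ⟨1, one_mem _, by simp⟩
    · rintro S ⟨y, hy, hyS⟩ T ⟨z, hz, hzT⟩
      have hI : ∏ α ∈ S ∩ T, fiberDisc p q (α : AlgebraicClosure K) ≠ 0 :=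
        Finset.prod_ne_zero_iff.2 fun α _ => h0 α
      refine ⟨y * z / ∏ α ∈ S ∩ T, fiberDisc p q (α : AlgebraicClosure K),
        div_mem (mul_mem hy hz) (prod_mem fun α _ => ha α), ?_⟩
      rw [div_pow, mul_pow, hyS, hzT, div_eq_iff (pow_ne_zero 2 hI)]
      have e1 := Finset.prod_union_inter (s₁ := S) (s₂ := T)
        (f := fun α : A => fiberDisc p q (α : AlgebraicClosure K))
      have e2 : ∏ α ∈ S ∪ T, fiberDisc p q (α : AlgebraicClosure K) =
          (∏ α ∈ symmDiff S T, fiberDisc p q (α : AlgebraicClosure K)) *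
            ∏ α ∈ S ∩ T, fiberDisc p q (α : AlgebraicClosure K) := by
        rw [← Finset.prod_union]
        · congr 1
          exact (symmDiff_sup_inf S T).symm
        · exact disjoint_symmDiff_inf S T
      rw [← e1, e2]; ring
    · rintro _ ⟨σ, rfl⟩ S ⟨y, hy, hyS⟩
      refine ⟨σ y, algEquiv_mem_iterField σ n hy, ?_⟩
      rw [← map_pow, hyS, map_prod, Finset.prod_map]
      refine Finset.prod_congr rfl fun α _ => ?_
      rw [← fiberDisc_algEquiv]
      rfl

end Galois
end RatDyn

/-! ### Critical values and the product of the discriminants -/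

namespace RatDyn

section Critical

variable {K : Type*} [Field K] {L : Type*} [Field L] [Algebra K L]

theorem aeval_derivative {f : K[X]} (hf : f.natDegree ≤ 2) (x : L) :
    aeval x (derivative f) =
      2 * algebraMap K L (f.coeff 2) * x + algebraMap K L (f.coeff 1) := by
  conv_lhs => rw [eq_of_natDegree_le_two hf]
  simp
  ring

theorem critPoly_eq {p q : K[X]} (hd : deg p q = 2) :
    critPoly p q = C (p.coeff 2 * q.coeff 1 - p.coeff 1 * q.coeff 2) * X ^ 2 +
      C (2 * (p.coeff 2 * q.coeff 0 - p.coeff 0 * q.coeff 2)) * X +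
      C (p.coeff 1 * q.coeff 0 - p.coeff 0 * q.coeff 1) := by
  obtain ⟨hp, hq⟩ := natDegree_le_of_deg hd
  have key : ∀ a0 a1 a2 b0 b1 b2 : K,
      critPoly (C a0 + C a1 * X + C a2 * X ^ 2) (C b0 + C b1 * X + C b2 * X ^ 2) =
      C (a2 * b1 - a1 * b2) * X ^ 2 + C (2 * (a2 * b0 - a0 * b2)) * X +
      C (a1 * b0 - a0 * b1) := by
    intro a0 a1 a2 b0 b1 b2
    have h2 : (C 2 : K[X]) = 2 := rfl
    simp only [critPoly, derivative_add, derivative_C, derivative_C_mul, derivative_X,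
      derivative_X_pow, C_sub, C_mul, h2, Nat.cast_ofNat]
    simp
    ring
  conv_lhs => rw [eq_of_natDegree_le_two hp, eq_of_natDegree_le_two hq]
  rw [key]

theorem coeff_two_critPoly {p q : K[X]} (hd : deg p q = 2) :
    (critPoly p q).coeff 2 = p.coeff 2 * q.coeff 1 - p.coeff 1 * q.coeff 2 := by
  rw [critPoly_eq hd]
  simp only [coeff_add, coeff_C_mul_X_pow, coeff_C_mul_X, coeff_C]
  simp

/-- A critical point `γ` with finite value `t` is a double zero of the form `P - t Q`. -/
theorem fiberDeriv_eq_zero_of_critical {p q : K[X]} (hd : deg p q = 2) {γ : L}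
    (hγ : aeval γ (critPoly p q) = 0) (hq0 : aeval γ q ≠ 0) :
    fiberDeriv p q (aeval γ p / aeval γ q) γ = 0 := by
  obtain ⟨hp, hq⟩ := natDegree_le_of_deg hd
  simp only [critPoly, map_sub, map_mul, aeval_derivative hp, aeval_derivative hq] at hγ
  unfold fiberDeriv
  field_simp
  linear_combination hγ

theorem ratMap_coe_eq_infty {p q : K[X]} {γ : L} :
    ratMap p q L (γ : OnePoint L) = ∞ ↔ aeval γ q = 0 := by
  by_cases h : aeval γ q = 0 <;> simp [ratMap, h]

theorem ratMap_coe_eq_coe {p q : K[X]} {γ t : L} :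
    ratMap p q L (γ : OnePoint L) = (t : OnePoint L) ↔
      aeval γ q ≠ 0 ∧ aeval γ p / aeval γ q = t := by
  by_cases h : aeval γ q = 0
  · simp [ratMap, h]
  · simp [ratMap, h]

/-- At a finite critical value `t` the form `P - t Q` is degenerate. -/
theorem fiberDisc_eq_zero_of_critical {p q : K[X]} (hd : deg p q = 2) {γ : OnePoint L} {t : L}
    (hγ : IsCritical p q γ) (ht : ratMap p q L γ = (t : OnePoint L)) : fiberDisc p q t = 0 := by
  induction γ using OnePoint.rec with
  | infty =>
    have hc : (critPoly p q).coeff 2 = 0 := by simpa [IsCritical, hd] using hγ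
    rw [coeff_two_critPoly hd] at hc
    have hc' := congrArg (algebraMap K L) hc
    simp only [map_sub, map_mul, map_zero] at hc'
    by_cases h2 : q.coeff 2 = 0
    · simp [ratMap, hd, h2] at ht
    · have ht' : algebraMap K L (p.coeff 2) / algebraMap K L (q.coeff 2) = t := by
        simpa [ratMap, hd, h2] using ht
      have h2' : algebraMap K L (q.coeff 2) ≠ 0 := by simpa using h2
      unfold fiberDisc
      rw [← ht']
      field_simp
      linear_combination (algebraMap K L (p.coeff 2) * algebraMap K L (q.coeff 1) -
        algebraMap K L (p.coeff 1) * algebraMap K L (q.coeff 2)) * hc'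
  | coe γ =>
    obtain ⟨hq0, rfl⟩ := ratMap_coe_eq_coe.1 ht
    rw [← fiberDeriv_sq hd (x := γ) (by field_simp), fiberDeriv_eq_zero_of_critical hd hγ hq0]
    simp

/-- If `∞` is a critical value, then the form `Q` is degenerate. -/
theorem denomDisc_eq_zero_of_critical {p q : K[X]} (hpq : IsCoprime p q) (hd : deg p q = 2)
    {γ : OnePoint L} (hγ : IsCritical p q γ) (ht : ratMap p q L γ = ∞) :
    q.coeff 1 ^ 2 - 4 * q.coeff 2 * q.coeff 0 = 0 := by
  obtain ⟨hp, hq⟩ := natDegree_le_of_deg hd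
  induction γ using OnePoint.rec with
  | infty =>
    have hc : (critPoly p q).coeff 2 = 0 := by simpa [IsCritical, hd] using hγ
    rw [coeff_two_critPoly hd] at hc
    have h2 : q.coeff 2 = 0 := by
      by_contra h2
      simp [ratMap, hd, h2] at ht
    have hp2 := (coeff_two_ne_zero hd).resolve_right (by simp [h2])
    have h1 : q.coeff 1 = 0 := by simpa [h2, hp2] using hc
    simp [h1, h2]
  | coe γ =>
    have hq0 := ratMap_coe_eq_infty.1 ht
    have hp0 := (aeval_ne_zero_or hpq γ).resolve_right (by simpa using hq0)
    have hc : aeval γ (critPoly p q) = 0 := hγ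
    simp only [critPoly, map_sub, map_mul, aeval_derivative hq, hq0] at hc
    have hc' : 2 * algebraMap K L (q.coeff 2) * γ + algebraMap K L (q.coeff 1) = 0 := by
      simpa [hp0] using hc
    rw [aeval_eq_form hq] at hq0
    simp only [form] at hq0
    apply (algebraMap K L).injective
    simp only [map_sub, map_mul, map_pow, map_zero, map_ofNat]
    linear_combination (2 * algebraMap K L (q.coeff 2) * γ + algebraMap K L (q.coeff 1)) * hc' -
      4 * algebraMap K L (q.coeff 2) * hq0

theorem aeval_eq_mul_prod {f : K[X]} (hf : f.Separable) (t : AlgebraicClosure K) :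
    aeval t f = algebraMap K (AlgebraicClosure K) f.leadingCoeff *
      ∏ α : f.rootSet (AlgebraicClosure K), (t - (α : AlgebraicClosure K)) := by
  have h := (IsAlgClosed.splits (f.map (algebraMap K (AlgebraicClosure K)))).eq_prod_roots
  rw [← eval_map_algebraMap, h]
  rw [eval_mul, eval_C, leadingCoeff_map]
  congr 1
  rw [eval_multiset_prod, Multiset.map_map]
  simp only [Function.comp_def, eval_sub, eval_X, eval_C]
  have hnd : (f.map (algebraMap K (AlgebraicClosure K))).roots.Nodup :=
    nodup_roots (hf.map)
  classical
  rw [Finset.prod_set_coe (s := f.rootSet (AlgebraicClosure K))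
    (f := fun α => t - α)]
  unfold Finset.prod
  congr 2
  have : (f.rootSet (AlgebraicClosure K)).toFinset = (f.aroots (AlgebraicClosure K)).toFinset := by
    ext; simp [rootSet_def]
  rw [this, Multiset.toFinset_val, aroots, Multiset.dedup_eq_self.2 hnd]

/-- Multiplication by the square of a nonzero element of `K` does not change being a square. -/
theorem exists_sq_eq_iff_of_eq_sq_mul (F : IntermediateField K L) {c : K} (hc : c ≠ 0) {a b : L}
    (hab : a = algebraMap K L c ^ 2 * b) :
    (∃ y ∈ F, y ^ 2 = a) ↔ ∃ y ∈ F, y ^ 2 = b := by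
  have hc' : algebraMap K L c ≠ 0 := by simpa using hc
  constructor
  · rintro ⟨y, hy, e⟩
    refine ⟨y / algebraMap K L c, div_mem hy (F.algebraMap_mem c), ?_⟩
    rw [div_pow, e, hab]; field_simp
  · rintro ⟨y, hy, e⟩
    exact ⟨algebraMap K L c * y, mul_mem (F.algebraMap_mem c) hy, by rw [mul_pow, e, hab]⟩

variable [CharZero K]

theorem charZero_of_algebra (K L : Type*) [Field K] [CharZero K] [Field L] [Algebra K L] :
    CharZero L := charZero_of_injective_algebraMap (algebraMap K L).injective

/-- A nonzero form `P - t Q` has at most one double zero, so distinct critical points have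
distinct values. -/
theorem critical_value_ne {p q : K[X]} (hpq : IsCoprime p q) (hd : deg p q = 2)
    {γ₁ γ₂ : OnePoint L} (hne : γ₁ ≠ γ₂) (h₁ : IsCritical p q γ₁) (h₂ : IsCritical p q γ₂)
    {t₁ t₂ : L} (ht₁ : ratMap p q L γ₁ = (t₁ : OnePoint L))
    (ht₂ : ratMap p q L γ₂ = (t₂ : OnePoint L)) : t₁ ≠ t₂ := by
  have := charZero_of_algebra K L
  rintro rfl
  have hpen := pencil_ne_zero (L := L) hpq hd (x := 1) (y := t₁) (by simp)
  simp only [one_mul] at hpen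
  -- a finite double zero, in terms of the coefficients of `P - t Q`
  have hfin : ∀ γ : L, IsCritical p q (γ : OnePoint L) →
      ratMap p q L (γ : OnePoint L) = (t₁ : OnePoint L) →
      fiberDeriv p q t₁ γ = 0 ∧ (algebraMap K L (p.coeff 2) - t₁ * algebraMap K L (q.coeff 2)) *
        γ ^ 2 + (algebraMap K L (p.coeff 1) - t₁ * algebraMap K L (q.coeff 1)) * γ +
        (algebraMap K L (p.coeff 0) - t₁ * algebraMap K L (q.coeff 0)) = 0 := by
    intro γ hγ ht
    obtain ⟨hq0, rfl⟩ := ratMap_coe_eq_coe.1 ht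
    exact ⟨fiberDeriv_eq_zero_of_critical hd hγ hq0, fiber_quadratic hd (by field_simp)⟩
  have hinf : IsCritical p q (∞ : OnePoint L) → ratMap p q L ∞ = (t₁ : OnePoint L) →
      algebraMap K L (p.coeff 2) - t₁ * algebraMap K L (q.coeff 2) = 0 := by
    intro hγ ht
    by_cases h2 : q.coeff 2 = 0
    · simp [ratMap, hd, h2] at ht
    · have ht' : algebraMap K L (p.coeff 2) / algebraMap K L (q.coeff 2) = t₁ := by
        simpa [ratMap, hd, h2] using ht
      have h2' : algebraMap K L (q.coeff 2) ≠ 0 := by simpa using h2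
      rw [← ht']; field_simp; ring
  -- it is enough that the leading coefficient of `P - t Q` vanishes and one zero is finite
  have fin : ∀ γ : L, IsCritical p q (γ : OnePoint L) →
      ratMap p q L (γ : OnePoint L) = (t₁ : OnePoint L) →
      algebraMap K L (p.coeff 2) - t₁ * algebraMap K L (q.coeff 2) = 0 → False := by
    intro γ hγ ht hA
    obtain ⟨e1, e2⟩ := hfin γ hγ ht
    unfold fiberDeriv at e1
    rw [hA] at e1 e2
    have hB : algebraMap K L (p.coeff 1) - t₁ * algebraMap K L (q.coeff 1) = 0 := by
      simpa using e1
    rw [hB] at e2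
    have hC : algebraMap K L (p.coeff 0) - t₁ * algebraMap K L (q.coeff 0) = 0 := by
      simpa using e2
    simp [hA, hB, hC] at hpen
  induction γ₁ using OnePoint.rec with
  | infty =>
    induction γ₂ using OnePoint.rec with
    | infty => exact hne rfl
    | coe γ₂ => exact fin γ₂ h₂ ht₂ (hinf h₁ ht₁)
  | coe γ₁ =>
    induction γ₂ using OnePoint.rec with
    | infty => exact fin γ₁ h₁ ht₁ (hinf h₂ ht₂)
    | coe γ₂ =>
      refine fin γ₁ h₁ ht₁ ?_
      have hne' : γ₁ - γ₂ ≠ 0 := sub_ne_zero.2 fun e => hne (by rw [e])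
      have e1 := (hfin γ₁ h₁ ht₁).1
      have e2 := (hfin γ₂ h₂ ht₂).1
      unfold fiberDeriv at e1 e2
      apply mul_left_cancel₀ (mul_ne_zero two_ne_zero hne')
      linear_combination e1 - e2

/-- The discriminant of `P - t Q` as a polynomial in `t` is not degenerate: its own discriminant
is sixteen times the resultant of `P` and `Q`. -/
theorem fiberDisc_middle_ne_zero {p q : K[X]} (hpq : IsCoprime p q) (hd : deg p q = 2)
    (hC : q.coeff 1 ^ 2 - 4 * q.coeff 2 * q.coeff 0 = 0) :
    p.coeff 1 * q.coeff 1 - 2 * p.coeff 2 * q.coeff 0 - 2 * p.coeff 0 * q.coeff 2 ≠ 0 := by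
  intro hM
  have h4 : (4 : K) ≠ 0 := by norm_num
  refine quadResultant_ne_zero hpq hd (mul_left_cancel₀ h4 ?_)
  linear_combination (p.coeff 1 * q.coeff 1 - 2 * p.coeff 2 * q.coeff 0 -
    2 * p.coeff 0 * q.coeff 2) * hM - (p.coeff 1 ^ 2 - 4 * p.coeff 2 * p.coeff 0) * hC

/-- The discriminant of `P - t Q`, a quadratic polynomial in `t`, factors over the two critical
values. -/
theorem fiberDisc_eq_mul {p q : K[X]} (hpq : IsCoprime p q) (hd : deg p q = 2)
    {γ₁ γ₂ : OnePoint L} (hne : γ₁ ≠ γ₂) (h₁ : IsCritical p q γ₁) (h₂ : IsCritical p q γ₂)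
    {t₁ t₂ : L} (ht₁ : ratMap p q L γ₁ = (t₁ : OnePoint L))
    (ht₂ : ratMap p q L γ₂ = (t₂ : OnePoint L)) :
    ∃ c : K, c ≠ 0 ∧ ∀ t : L, fiberDisc p q t = algebraMap K L c * ((t - t₁) * (t - t₂)) := by
  have := charZero_of_algebra K L
  have hd₁ := fiberDisc_eq_zero_of_critical hd h₁ ht₁
  have hd₂ := fiberDisc_eq_zero_of_critical hd h₂ ht₂
  have ht := sub_ne_zero.2 (critical_value_ne hpq hd hne h₁ h₂ ht₁ ht₂)
  set M := p.coeff 1 * q.coeff 1 - 2 * p.coeff 2 * q.coeff 0 - 2 * p.coeff 0 * q.coeff 2 with hM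
  -- Vieta: the sum of the two roots
  have hsum : algebraMap K L (q.coeff 1 ^ 2 - 4 * q.coeff 2 * q.coeff 0) * (t₁ + t₂) =
      2 * algebraMap K L M := by
    apply mul_left_cancel₀ ht
    rw [hM]
    simp only [map_sub, map_mul, map_pow, map_ofNat]
    unfold fiberDisc at hd₁ hd₂
    linear_combination hd₁ - hd₂
  refine ⟨q.coeff 1 ^ 2 - 4 * q.coeff 2 * q.coeff 0, ?_, fun t => ?_⟩
  · intro hC
    rw [hC, map_zero, zero_mul] at hsum
    refine fiberDisc_middle_ne_zero hpq hd hC ?_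
    rw [← hM]
    simpa using hsum.symm
  · rw [hM] at hsum
    simp only [map_sub, map_mul, map_pow, map_ofNat] at hsum ⊢
    unfold fiberDisc at hd₁ ⊢
    linear_combination hd₁ + (t - t₁) * hsum

/-- If one of the critical values is `∞`, then the discriminant of `P - t Q` is linear in `t`. -/
theorem fiberDisc_eq_mul_of_infty {p q : K[X]} (hpq : IsCoprime p q) (hd : deg p q = 2)
    {γ₁ γ₂ : OnePoint L} (h₁ : IsCritical p q γ₁) (h₂ : IsCritical p q γ₂)
    {t₁ : L} (ht₁ : ratMap p q L γ₁ = (t₁ : OnePoint L)) (ht₂ : ratMap p q L γ₂ = ∞) :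
    ∃ c : K, c ≠ 0 ∧ ∀ t : L, fiberDisc p q t = algebraMap K L c * (t - t₁) := by
  have hd₁ := fiberDisc_eq_zero_of_critical hd h₁ ht₁
  have hC := denomDisc_eq_zero_of_critical hpq hd h₂ ht₂
  refine ⟨_, mul_ne_zero (neg_ne_zero.2 (two_ne_zero (α := K)))
    (fiberDisc_middle_ne_zero hpq hd hC), fun t => ?_⟩
  have hC' := congrArg (algebraMap K L) hC
  simp only [map_sub, map_mul, map_pow, map_ofNat, map_zero, map_neg] at hC' ⊢
  unfold fiberDisc at hd₁ ⊢
  linear_combination hd₁ + (t ^ 2 - t₁ ^ 2) * hC'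

/-- The product formula for `p_n(t)`; the signs cancel because for `n ≥ 1` the degree `2 ^ n` of
`p_n` is even. -/
theorem prod_sub_rootSet {p q : K[X]} (hd : deg p q = 2) {n : ℕ} (hn : 1 ≤ n)
    (h : (iterNum p q n).coeff (2 ^ n) ≠ 0) (hirr : Irreducible (iterNum p q n))
    (t : AlgebraicClosure K) :
    algebraMap K (AlgebraicClosure K) (iterNum p q n).leadingCoeff *
      ∏ α : (iterNum p q n).rootSet (AlgebraicClosure K), ((α : AlgebraicClosure K) - t) =
      aeval t (iterNum p q n) := by
  rw [aeval_eq_mul_prod hirr.separable t]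
  congr 1
  have : ∀ α : (iterNum p q n).rootSet (AlgebraicClosure K),
      t - (α : AlgebraicClosure K) = (-1) * ((α : AlgebraicClosure K) - t) := fun α => by ring
  simp only [this]
  rw [Finset.prod_mul_distrib, Finset.prod_const, Finset.card_univ,
    card_rootSet_iterNum hd h hirr, Even.neg_one_pow, one_mul]
  exact (Nat.even_pow.2 ⟨even_two, by omega⟩)

/-- Up to squares of `K`, the product of the discriminants over the roots of `p_n` is
`p_n(t₁) p_n(t₂)`, for the two critical values `t₁` and `t₂`: since `n ≥ 1`, constants of `K`
contribute even powers to products over the `2 ^ n` roots. -/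
theorem exists_prod_fiberDisc_eq {p q : K[X]} (hpq : IsCoprime p q) (hd : deg p q = 2)
    {γ₁ γ₂ : OnePoint (AlgebraicClosure K)} (hne : γ₁ ≠ γ₂) (h₁ : IsCritical p q γ₁)
    (h₂ : IsCritical p q γ₂) {t₁ t₂ : AlgebraicClosure K}
    (ht₁ : ratMap p q _ γ₁ = (t₁ : OnePoint (AlgebraicClosure K)))
    (ht₂ : ratMap p q _ γ₂ = (t₂ : OnePoint (AlgebraicClosure K)))
    {n : ℕ} (hn : 1 ≤ n)
    (h : (iterNum p q n).coeff (2 ^ n) ≠ 0) (hirr : Irreducible (iterNum p q n)) :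
    ∃ c : K, c ≠ 0 ∧ ∏ α : (iterNum p q n).rootSet (AlgebraicClosure K),
        fiberDisc p q (α : AlgebraicClosure K) =
      algebraMap K (AlgebraicClosure K) c ^ 2 *
        (aeval t₁ (iterNum p q n) * aeval t₂ (iterNum p q n)) := by
  obtain ⟨c, hc, hδ⟩ := fiberDisc_eq_mul hpq hd hne h₁ h₂ ht₁ ht₂
  obtain ⟨m, rfl⟩ := Nat.exists_eq_add_of_le' hn
  have hl : (iterNum p q (m + 1)).leadingCoeff ≠ 0 := leadingCoeff_ne_zero.2 hirr.ne_zero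
  have hl' : algebraMap K (AlgebraicClosure K) (iterNum p q (m + 1)).leadingCoeff ≠ 0 := by
    simpa using hirr.ne_zero
  refine ⟨c ^ 2 ^ m / (iterNum p q (m + 1)).leadingCoeff, div_ne_zero (pow_ne_zero _ hc) hl, ?_⟩
  simp only [hδ]
  rw [← prod_sub_rootSet hd hn h hirr t₁, ← prod_sub_rootSet hd hn h hirr t₂,
    Finset.prod_mul_distrib, Finset.prod_mul_distrib, Finset.prod_const, Finset.card_univ,
    card_rootSet_iterNum hd h hirr, map_div₀, map_pow, pow_succ, pow_mul]
  field_simp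

/-- If one of the critical values is `∞`, then `ℓ(p_n)` takes the place of the value of `p_n` at
it. -/
theorem exists_prod_fiberDisc_eq_of_infty {p q : K[X]} (hpq : IsCoprime p q) (hd : deg p q = 2)
    {γ₁ γ₂ : OnePoint (AlgebraicClosure K)} (h₁ : IsCritical p q γ₁)
    (h₂ : IsCritical p q γ₂) {t₁ : AlgebraicClosure K}
    (ht₁ : ratMap p q _ γ₁ = (t₁ : OnePoint (AlgebraicClosure K)))
    (ht₂ : ratMap p q (AlgebraicClosure K) γ₂ = ∞)
    {n : ℕ} (hn : 1 ≤ n)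
    (h : (iterNum p q n).coeff (2 ^ n) ≠ 0) (hirr : Irreducible (iterNum p q n)) :
    ∃ c : K, c ≠ 0 ∧ ∏ α : (iterNum p q n).rootSet (AlgebraicClosure K),
        fiberDisc p q (α : AlgebraicClosure K) =
      algebraMap K (AlgebraicClosure K) c ^ 2 *
        (algebraMap K (AlgebraicClosure K) (iterNum p q n).leadingCoeff *
          aeval t₁ (iterNum p q n)) := by
  obtain ⟨c, hc, hδ⟩ := fiberDisc_eq_mul_of_infty hpq hd h₁ h₂ ht₁ ht₂
  obtain ⟨m, rfl⟩ := Nat.exists_eq_add_of_le' hn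
  have hl : (iterNum p q (m + 1)).leadingCoeff ≠ 0 := leadingCoeff_ne_zero.2 hirr.ne_zero
  have hl' : algebraMap K (AlgebraicClosure K) (iterNum p q (m + 1)).leadingCoeff ≠ 0 := by
    simpa using hirr.ne_zero
  refine ⟨c ^ 2 ^ m / (iterNum p q (m + 1)).leadingCoeff, div_ne_zero (pow_ne_zero _ hc) hl, ?_⟩
  simp only [hδ]
  rw [← prod_sub_rootSet hd hn h hirr t₁,
    Finset.prod_mul_distrib, Finset.prod_const, Finset.card_univ,
    card_rootSet_iterNum hd h hirr, map_div₀, map_pow, pow_succ, pow_mul]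
  field_simp

end Critical
end RatDyn

/-! ### Valuations and ramification in quadratic extensions -/

namespace RatDyn

section Valuation

variable {L : Type*} [Field L] {Γ : Type*} [LinearOrderedCommGroupWithZero Γ] (v : Valuation L Γ)

theorem val_eq_one_of_mul {x y : L} (hx : v x ≤ 1) (hy : v y ≤ 1) (h : v (x * y) = 1) :
    v x = 1 := by
  refine le_antisymm hx (not_lt.1 fun hlt => ?_)
  rw [map_mul] at h
  exact (mul_lt_one_of_lt_of_le hlt hy).ne h

/-- If the product of `x` and `y` is a unit, then both are units, or one of them is not integral and
dominates the difference. -/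
theorem val_pair_cases {x y : L} (h : v (x * y) = 1) :
    (v x = 1 ∧ v y = 1) ∨ (1 < v x ∧ v y = (v x)⁻¹ ∧ v (x - y) = v x) ∨
      (1 < v y ∧ v x = (v y)⁻¹ ∧ v (x - y) = v y) := by
  rw [map_mul] at h
  have hy : v y = (v x)⁻¹ := eq_inv_of_mul_eq_one_right h
  have hx : v x = (v y)⁻¹ := eq_inv_of_mul_eq_one_left h
  have hx0 : v x ≠ 0 := left_ne_zero_of_mul_eq_one h
  rcases lt_trichotomy (v x) 1 with hlt | heq | hgt
  · have hy1 : 1 < v y := by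
      rw [hy]; exact (one_lt_inv₀ (zero_lt_iff.2 hx0)).2 hlt
    exact Or.inr (Or.inr ⟨hy1, hx, Valuation.map_sub_eq_of_lt_right v (hlt.trans hy1)⟩)
  · exact Or.inl ⟨heq, by rw [hy, heq, inv_one]⟩
  · have hy1 : v y < 1 := by rw [hy]; exact inv_lt_one_of_one_lt₀ hgt
    exact Or.inr (Or.inl ⟨hgt, hy, Valuation.map_sub_eq_of_lt_left v (hy1.trans hgt)⟩)

/-- Two elements whose product is a unit and whose difference is integral are units. -/
theorem val_pair_eq_one {x y : L} (h : v (x * y) = 1) (hd : v (x - y) ≤ 1) :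
    v x = 1 ∧ v y = 1 := by
  rcases val_pair_cases v h with h | ⟨h1, -, h2⟩ | ⟨h1, -, h2⟩
  · exact h
  · exact absurd (h2 ▸ hd) (not_le.2 h1)
  · exact absurd (h2 ▸ hd) (not_le.2 h1)

theorem val_le_one_sub {x y : L} (hx : v x ≤ 1) (hy : v y ≤ 1) : v (x - y) ≤ 1 :=
  (Valuation.map_sub v x y).trans (max_le hx hy)

theorem val_le_one_mul {x y : L} (hx : v x ≤ 1) (hy : v y ≤ 1) : v (x * y) ≤ 1 := by
  rw [map_mul]; exact mul_le_one' hx hy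

theorem val_natCast_le_one (n : ℕ) : v (n : L) ≤ 1 := by
  have : (n : L) ∈ v.valuationSubring := natCast_mem _ n
  exact this

variable {K : Type*} [Field K] [Algebra K L]

/-- Let `β` be an integral root of a quadratic over the valuation ring of `E` at which the
derivative is a unit. Adjoining `β` does not enlarge the value group: for `c` in the valuation
ring of `E`, either `β - c` is a unit, or it has the value of the quadratic at `c`. -/
theorem exists_val_add_mul_root_eq_of_le_one (E : IntermediateField K L) {A B C β : L}
    (hA : A ∈ E) (hB : B ∈ E) (hC : C ∈ E) (hAv : v A ≤ 1) (hβv : v β ≤ 1)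
    (hβ : A * β ^ 2 + B * β + C = 0) (hder : v (2 * A * β + B) = 1) {d e : L} (hd : d ∈ E)
    (he : e ∈ E) : ∃ f ∈ E, v (e + d * β) = v f := by
  by_cases hd0 : d = 0
  · exact ⟨e, he, by simp [hd0]⟩
  set c := -(e / d) with hc
  have hcE : c ∈ E := neg_mem (div_mem he hd)
  have hed : e + d * β = d * (β - c) := by rw [hc]; field_simp; ring
  suffices ∃ f ∈ E, v (β - c) = v f by
    obtain ⟨f, hf, hfv⟩ := this
    exact ⟨d * f, mul_mem hd hf, by rw [hed, map_mul, map_mul, hfv]⟩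
  rcases lt_or_ge 1 (v c) with hc1 | hc1
  · exact ⟨c, hcE, Valuation.map_sub_eq_of_lt_right v (hβv.trans_lt hc1)⟩
  rcases (val_le_one_sub v hβv hc1).eq_or_lt with h1 | h1
  · exact ⟨1, one_mem _, by rw [h1, map_one]⟩
  · refine ⟨A * c ^ 2 + B * c + C, add_mem (add_mem (mul_mem hA (pow_mem hcE 2))
      (mul_mem hB hcE)) hC, ?_⟩
    have hfac : A * c ^ 2 + B * c + C =
        (β - c) * (A * (β - c) - (2 * A * β + B)) := by linear_combination hβ
    have hu : v (A * (β - c) - (2 * A * β + B)) = 1 := by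
      rw [← hder]
      refine Valuation.map_sub_eq_of_lt_right v ?_
      rw [hder, map_mul]
      rw [mul_comm]
      exact mul_lt_one_of_lt_of_le h1 hAv
    rw [hfac, map_mul, hu, mul_one]

/-- Adjoining the square root `2Aβ + B` of the unit discriminant of a quadratic `Ax² + Bx + C`
over the valuation ring of `E`, with root `β`, does not enlarge the value group. -/
theorem exists_val_add_mul_deriv_eq (E : IntermediateField K L) {A B C β : L}
    (hA : A ∈ E) (hB : B ∈ E) (hC : C ∈ E) (hAv : v A ≤ 1) (hCv : v C ≤ 1)
    (hβ : A * β ^ 2 + B * β + C = 0) (hder : v (2 * A * β + B) = 1) {d e : L} (hd : d ∈ E)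
    (he : e ∈ E) : ∃ f ∈ E, v (e + d * (2 * A * β + B)) = v f := by
  have h2 : (2 : L) ∈ E := ofNat_mem E 2
  rcases le_or_gt (v β) 1 with hβv | hβv
  · have := exists_val_add_mul_root_eq_of_le_one v E hA hB hC hAv hβv hβ hder
      (d := d * (2 * A)) (e := e + d * B) (mul_mem hd (mul_mem h2 hA)) (add_mem he (mul_mem hd hB))
    rwa [show e + d * B + d * (2 * A) * β = e + d * (2 * A * β + B) by ring] at this
  · -- the inverse of a nonintegral root is an integral root of the reversed quadratic
    have hβ0 : β ≠ 0 := by rintro rfl; simp at hβv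
    have hder' : 2 * C * β⁻¹ + B = -(2 * A * β + B) := by
      field_simp
      linear_combination 2 * hβ
    have := exists_val_add_mul_root_eq_of_le_one v E (A := C) (B := B) (C := A) (β := β⁻¹)
      hC hB hA hCv (by rw [map_inv₀]; exact (inv_lt_one_of_one_lt₀ hβv).le)
      (by field_simp; linear_combination hβ) (by rw [hder', Valuation.map_neg, hder])
      (d := -(d * (2 * C))) (e := e - d * B) (neg_mem (mul_mem hd (mul_mem h2 hC)))
      (sub_mem he (mul_mem hd hB))
    rwa [show e - d * B + -(d * (2 * C)) * β⁻¹ = e + d * (2 * A * β + B) by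
      linear_combination -d * hder'] at this

/-- Every value of the valuation on `E` is already taken on `K`, that is, `E / K` has
ramification index one. -/
def ValuesIn (E : IntermediateField K L) : Prop :=
  ∀ z ∈ E, ∃ c : K, v z = v (algebraMap K L c)

/-- Ramification index one is preserved by adjoining square roots `s i`, if none of them enlarges
the value group of a field over `F`. -/
theorem valuesIn_sup_adjoin {ι : Type*} [DecidableEq ι]
    (F : IntermediateField K L) (hF : ValuesIn v F) (s : ι → L) (S : Finset ι)
    (hs : ∀ i ∈ S, s i ^ 2 ∈ F)
    (hstep : ∀ i ∈ S, ∀ E : IntermediateField K L, F ≤ E → ∀ e ∈ E, ∀ d ∈ E,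
      ∃ f ∈ E, v (e + d * s i) = v f) :
    ValuesIn v (F ⊔ IntermediateField.adjoin K (s '' S)) := by
  induction S using Finset.induction_on with
  | empty => simpa using hF
  | insert j S hj ih =>
    rw [IntermediateField.sup_adjoin_image_insert]
    have ih' := ih (fun i hi => hs i (Finset.mem_insert_of_mem hi))
      (fun i hi => hstep i (Finset.mem_insert_of_mem hi))
    set E := F ⊔ IntermediateField.adjoin K (s '' S)
    have hFE : F ≤ E := le_sup_left
    intro z hz
    obtain ⟨u, hu, w, hw, rfl⟩ := E.exists_eq_add_mul_of_mem_sup_adjoin_sqrt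
      (hFE (hs j (Finset.mem_insert_self _ _))) hz
    obtain ⟨f, hf, e⟩ := hstep j (Finset.mem_insert_self _ _) E hFE u hu w hw
    obtain ⟨c, hc⟩ := ih' f hf
    exact ⟨c, e.trans hc⟩

/-- If `F / K` has ramification index one and the `a i` have the values of squares, then an
element of `K` that becomes a square after adjoining square roots of the `a i` to `F` has the
value of a square. -/
theorem exists_val_mul_sq_eq [NeZero (2 : L)] {ι : Type*} [DecidableEq ι]
    (F : IntermediateField K L) (hF : ValuesIn v F) (a s : ι → L) (ha : ∀ i, a i ∈ F)
    (hs : ∀ i, s i ^ 2 = a i) (S : Finset ι)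
    (hval : ∀ i, ∃ c : K, c ≠ 0 ∧ v (a i) = v (algebraMap K L c) ^ 2) {b : K} {y : L}
    (hy : y ∈ F ⊔ IntermediateField.adjoin K (s '' S)) (hyb : y ^ 2 = algebraMap K L b) :
    ∃ c d : K, c ≠ 0 ∧ v (algebraMap K L (b * c ^ 2)) = v (algebraMap K L (d ^ 2)) := by
  obtain ⟨T, -, z, hz, e⟩ := F.exists_mul_prod_eq_sq a s ha hs S (F.algebraMap_mem b) hy hyb
  choose c hc hcv using hval
  obtain ⟨d, hd⟩ := hF z hz
  refine ⟨∏ i ∈ T, c i, d, Finset.prod_ne_zero_iff.2 fun i _ => hc i, ?_⟩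
  rw [map_pow, map_pow, ← hd, ← map_pow, e, map_mul, map_mul, map_mul, map_pow, map_pow,
    map_prod, map_prod, map_prod, ← Finset.prod_pow]
  simp only [hcv]

end Valuation

section LocalGeometry

variable {L : Type*} [Field L] {Γ : Type*} [LinearOrderedCommGroupWithZero Γ] (v : Valuation L Γ)

/-- If `α₁ - α₂` is a unit, `τ₁` and `τ₂` differ from `Q` by integral elements, and the
products `(1 - α₁ τᵢ)(1 - α₂ τᵢ)` are units, then `(1 - α₁ τ₁)(1 - α₁ τ₂)` has the value of a
square: up to squares the two factors have the same value, which is a power of that of `Q`. -/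
theorem val_mul_eq_sq {α₁ α₂ Q ψ₁ ψ₂ : L} (hα : v (α₁ - α₂) = 1) (hψ₁ : v ψ₁ ≤ 1)
    (hψ₂ : v ψ₂ ≤ 1) (h₁ : v ((1 - α₁ * (Q + ψ₁)) * (1 - α₂ * (Q + ψ₁))) = 1)
    (h₂ : v ((1 - α₁ * (Q + ψ₂)) * (1 - α₂ * (Q + ψ₂))) = 1) :
    ∃ c : L, (c = 1 ∨ Q ≠ 0 ∧ (c = Q ∨ c = Q⁻¹)) ∧
      v ((1 - α₁ * (Q + ψ₁)) * (1 - α₁ * (Q + ψ₂))) = v c ^ 2 := by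
  have hdiff : ∀ ψ, v ((1 - α₁ * (Q + ψ)) - (1 - α₂ * (Q + ψ))) = v (Q + ψ) := by
    intro ψ
    rw [show (1 - α₁ * (Q + ψ)) - (1 - α₂ * (Q + ψ)) = -((α₁ - α₂) * (Q + ψ)) by ring,
      Valuation.map_neg, map_mul, hα, one_mul]
  rcases le_or_gt (v Q) 1 with hQ | hQ
  · have key : ∀ ψ, v ψ ≤ 1 → v ((1 - α₁ * (Q + ψ)) * (1 - α₂ * (Q + ψ))) = 1 →
        v (1 - α₁ * (Q + ψ)) = 1 := fun ψ hψ h =>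
      (val_pair_eq_one v h ((hdiff ψ).trans_le
        ((Valuation.map_add v Q ψ).trans (max_le hQ hψ)))).1
    exact ⟨1, Or.inl rfl, by rw [map_mul, key _ hψ₁ h₁, key _ hψ₂ h₂]; simp⟩
  · have hQ0 : Q ≠ 0 := by rintro rfl; simp at hQ
    have hQv : v Q ≠ 0 := (Valuation.ne_zero_iff v).2 hQ0
    have key : ∀ ψ, v ψ ≤ 1 → v ((1 - α₁ * (Q + ψ)) * (1 - α₂ * (Q + ψ))) = 1 →
        v (1 - α₁ * (Q + ψ)) = v Q ∨ v (1 - α₁ * (Q + ψ)) = (v Q)⁻¹ := by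
      intro ψ hψ h
      have hτ : v (Q + ψ) = v Q := Valuation.map_add_eq_of_lt_left v (hψ.trans_lt hQ)
      have hd := (hdiff ψ).trans hτ
      rcases val_pair_cases v h with ⟨e1, e2⟩ | ⟨-, -, e⟩ | ⟨-, e', e⟩
      · have := val_le_one_sub v e1.le e2.le
        rw [hd] at this
        exact absurd this (not_le.2 hQ)
      · exact Or.inl (e.symm.trans hd)
      · exact Or.inr (by rw [e', ← e, hd])
    rw [map_mul]
    rcases key _ hψ₁ h₁ with e1 | e1 <;> rcases key _ hψ₂ h₂ with e2 | e2 <;> rw [e1, e2]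
    · exact ⟨Q, Or.inr ⟨hQ0, Or.inl rfl⟩, (sq _).symm⟩
    · exact ⟨1, Or.inl rfl, by simp [hQv]⟩
    · exact ⟨1, Or.inl rfl, by simp [hQv]⟩
    · exact ⟨Q⁻¹, Or.inr ⟨hQ0, Or.inr rfl⟩, by rw [map_inv₀, sq]⟩

/-- In coordinates `p = a (x - α₁)(x - α₂)` and `q = Q p + U x + V`, the unit conditions on the
first two steps of the orbit of the point `(1 : Q + ψ)` force `q`, and with it `p`, to be
integral. -/
theorem val_le_one_of_orbit {a α₁ α₂ U V Q ψ : L} (ha : v a = 1) (hU : v U = 1)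
    (hα : v (α₁ - α₂) = 1) (hρ₁ : v (U * α₁ + V) = 1) (hρ₂ : v (U * α₂ + V) = 1)
    (hψ : v ψ = 1) {X₁ Y₁ : L}
    (hX₁ : X₁ = a * ((1 - α₁ * (Q + ψ)) * (1 - α₂ * (Q + ψ))))
    (hY₁ : Y₁ = Q * X₁ + (U + V * (Q + ψ)) * (Q + ψ)) (h₁ : v X₁ = 1)
    (h₂ : v ((X₁ - α₁ * Y₁) * (X₁ - α₂ * Y₁)) = 1) : v V ≤ 1 ∧ v Q ≤ 1 := by
  set τ := Q + ψ with hτ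
  have h₁' : v ((1 - α₁ * τ) * (1 - α₂ * τ)) = 1 := by
    rw [hX₁, map_mul, ha, one_mul] at h₁; exact h₁
  have hV : v V ≤ 1 := by
    by_contra hV
    rw [not_le] at hV
    have hαV : ∀ α, v (U * α + V) = 1 → v α = v V := by
      intro α hρ
      have : v (U * α) = v V := by
        rw [show U * α = (U * α + V) - V by ring]
        exact Valuation.map_sub_eq_of_lt_right v (hρ.trans_lt hV)
      rwa [map_mul, hU, one_mul] at this
    have e₁ := hαV α₁ hρ₁
    have e₂ := hαV α₂ hρ₂
    have hVτ : v (V * τ) ≤ 1 := by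
      by_contra h
      rw [not_le] at h
      have key : ∀ α, v α = v V → v (1 - α * τ) = v (V * τ) := by
        intro α hα'
        have : v (α * τ) = v (V * τ) := by rw [map_mul, map_mul, hα']
        rw [← this]
        exact Valuation.map_sub_eq_of_lt_right v (by rwa [map_one, this])
      rw [map_mul, key _ e₁, key _ e₂] at h₁'
      exact (one_lt_mul'' h h).ne' h₁'
    have hτ1 : v τ < 1 := by
      by_contra h
      rw [not_lt] at h
      rw [map_mul] at hVτ
      exact absurd hVτ (not_le.2 (hV.trans_le (le_mul_of_one_le_right' h)))
    have hQ1 : v Q = 1 := by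
      rw [show Q = τ - ψ by rw [hτ]; ring, ← hψ]
      exact Valuation.map_sub_eq_of_lt_right v (hτ1.trans_eq hψ.symm)
    have hY : v Y₁ = 1 := by
      have hlt : v ((U + V * τ) * τ) < 1 := by
        rw [map_mul, mul_comm]
        exact mul_lt_one_of_lt_of_le hτ1 ((Valuation.map_add v _ _).trans (max_le hU.le hVτ))
      have hQX : v (Q * X₁) = 1 := by rw [map_mul, hQ1, h₁, one_mul]
      rw [hY₁, ← hQX]
      exact Valuation.map_add_eq_of_lt_left v (hlt.trans_eq hQX.symm)
    have key : ∀ α, v α = v V → v (X₁ - α * Y₁) = v V := by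
      intro α hα'
      have : v (α * Y₁) = v V := by rw [map_mul, hα', hY, mul_one]
      rw [← this]
      exact Valuation.map_sub_eq_of_lt_right v (by rw [h₁, this]; exact hV)
    rw [map_mul, key _ e₁, key _ e₂] at h₂
    exact (one_lt_mul'' hV hV).ne' h₂
  refine ⟨hV, ?_⟩
  by_contra hQ
  rw [not_le] at hQ
  have hQ0 : v Q ≠ 0 := (zero_lt_one.trans hQ).ne'
  have hτQ : v τ = v Q := Valuation.map_add_eq_of_lt_left v (hψ.trans_lt hQ)
  have hint : ∀ α, v (U * α + V) = 1 → v α ≤ 1 := by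
    intro α hρ
    have : v (U * α) ≤ 1 := by
      rw [show U * α = (U * α + V) - V by ring]
      exact val_le_one_sub v hρ.le hV
    rwa [map_mul, hU, one_mul] at this
  have hdiff : v ((1 - α₁ * τ) - (1 - α₂ * τ)) = v Q := by
    rw [show (1 - α₁ * τ) - (1 - α₂ * τ) = -((α₁ - α₂) * τ) by ring,
      Valuation.map_neg, map_mul, hα, one_mul, hτQ]
  -- one of the two roots is close to `τ⁻¹`, the other one is a unit
  have main : ∀ α α', v (U * α + V) = 1 → v (U * α' + V) = 1 → v (α - α') = 1 →
      v (1 - α' * τ) < 1 → v ((X₁ - α * Y₁) * (X₁ - α' * Y₁)) ≠ 1 := by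
    intro α α' hρ hρ' hαα' hlt
    have hατ : v (α' * τ) = 1 := by
      rw [show α' * τ = 1 - (1 - α' * τ) by ring, ← map_one v]
      exact Valuation.map_sub_eq_of_lt_left v (hlt.trans_eq (map_one v).symm)
    have hα'Q : v α' * v Q = 1 := by rw [← hτQ, ← map_mul, hατ]
    have hα'lt : v α' < 1 := by
      rw [eq_inv_of_mul_eq_one_left hα'Q]; exact inv_lt_one_of_one_lt₀ hQ
    have hα1 : v α = 1 := by
      rw [show α = (α - α') + α' by ring, ← hαα']
      exact Valuation.map_add_eq_of_lt_left v (hα'lt.trans_eq hαα'.symm)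
    have hV1 : v V = 1 := by
      rw [show V = (U * α' + V) - U * α' by ring, ← hρ']
      refine Valuation.map_sub_eq_of_lt_left v ?_
      rw [hρ', map_mul, hU, one_mul]; exact hα'lt
    have hVτ : v (U + V * τ) = v Q := by
      have : v (V * τ) = v Q := by rw [map_mul, hV1, one_mul, hτQ]
      rw [← this]
      exact Valuation.map_add_eq_of_lt_right v (by rw [this, hU]; exact hQ)
    have hQQ : v Q < v Q * v Q := lt_mul_of_one_lt_left (zero_lt_iff.2 hQ0) hQ
    have hY : v Y₁ = v Q * v Q := by
      have e : v ((U + V * τ) * τ) = v Q * v Q := by rw [map_mul, hVτ, hτQ]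
      rw [hY₁, ← e]
      refine Valuation.map_add_eq_of_lt_right v ?_
      rw [e, map_mul, h₁, mul_one]; exact hQQ
    have f : v (X₁ - α * Y₁) = v Q * v Q := by
      have e : v (α * Y₁) = v Q * v Q := by rw [map_mul, hα1, one_mul, hY]
      rw [← e]
      exact Valuation.map_sub_eq_of_lt_right v (by rw [e, h₁]; exact hQ.trans hQQ)
    have f' : v (X₁ - α' * Y₁) = v Q := by
      have e : v (α' * Y₁) = v Q := by rw [map_mul, hY, ← mul_assoc, hα'Q, one_mul]
      rw [← e]
      exact Valuation.map_sub_eq_of_lt_right v (by rw [e, h₁]; exact hQ)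
    rw [map_mul, f, f']
    exact (one_lt_mul'' (hQ.trans hQQ) hQ).ne'
  rcases val_pair_cases v h₁' with ⟨e1, e2⟩ | ⟨h, e, -⟩ | ⟨h, e, -⟩
  · have := val_le_one_sub v e1.le e2.le
    rw [hdiff] at this
    exact absurd this (not_le.2 hQ)
  · refine main α₁ α₂ hρ₁ hρ₂ hα ?_ h₂
    rw [e]; exact inv_lt_one_of_one_lt₀ h
  · refine main α₂ α₁ hρ₂ hρ₁ (by rw [Valuation.map_sub_swap]; exact hα) ?_
      (by rw [mul_comm]; exact h₂)
    rw [e]; exact inv_lt_one_of_one_lt₀ h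

end LocalGeometry
end RatDyn

/-! ### Local coordinates at a prime -/

namespace RatDyn

section UnitModel

variable {K : Type*} [Field K] {L : Type*} [Field L] [Algebra K L]
  {Γ : Type*} [LinearOrderedCommGroupWithZero Γ]

/-- Local coordinates for `p / q` at a valuation `v`, in which
`p = a (x - α₁)(x - α₂)` and `q = Q p + U x + V`. The two finite critical points `γᵢ` enter
through `ψᵢ = (U γᵢ + V) / p(γᵢ)`, so that `q(γᵢ) / p(γᵢ) = Q + ψᵢ`. The leading coefficients of
`p` and `c`, the discriminant of `p` and the resultant of `q` and `p` are units if and only if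
`a`, `U`, `α₁ - α₂` and the values `U αᵢ + V = q(αᵢ)` are; then the `ψᵢ` are units as well. Neither
`V` nor `Q` is assumed to be integral. -/
structure UnitModel (p q : K[X]) (v : Valuation L Γ) where
  (a U V Q : K)
  (α₁ α₂ ψ₁ ψ₂ : L)
  p_two : p.coeff 2 = a
  p_one : algebraMap K L (p.coeff 1) = -(algebraMap K L a * (α₁ + α₂))
  p_zero : algebraMap K L (p.coeff 0) = algebraMap K L a * (α₁ * α₂)
  q_two : q.coeff 2 = Q * p.coeff 2
  q_one : q.coeff 1 = Q * p.coeff 1 + U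
  q_zero : q.coeff 0 = Q * p.coeff 0 + V
  val_a : v (algebraMap K L a) = 1
  val_U : v (algebraMap K L U) = 1
  val_α : v (α₁ - α₂) = 1
  val_ρ₁ : v (algebraMap K L U * α₁ + algebraMap K L V) = 1
  val_ρ₂ : v (algebraMap K L U * α₂ + algebraMap K L V) = 1
  val_ψ₁ : v ψ₁ = 1
  val_ψ₂ : v ψ₂ = 1
  fiberDisc_eq : ∀ t : L, fiberDisc p q t = fiberDisc p q 0 *
    ((1 - t * (algebraMap K L Q + ψ₁)) * (1 - t * (algebraMap K L Q + ψ₂)))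

theorem leadingCoeff_critPoly {p q : K[X]} (hd : deg p q = 2)
    (h : p.coeff 2 * q.coeff 1 - p.coeff 1 * q.coeff 2 ≠ 0) :
    (critPoly p q).leadingCoeff = p.coeff 2 * q.coeff 1 - p.coeff 1 * q.coeff 2 := by
  rw [critPoly_eq hd, leadingCoeff_quadratic h]

theorem coeff_two_critPoly_ne_zero [CharZero K] {p q : K[X]} (hpq : IsCoprime p q)
    (hd : deg p q = 2) {γ₁ γ₂ : L} (hne : γ₁ ≠ γ₂) (h₁ : aeval γ₁ (critPoly p q) = 0)
    (h₂ : aeval γ₂ (critPoly p q) = 0) :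
    p.coeff 2 * q.coeff 1 - p.coeff 1 * q.coeff 2 ≠ 0 := by
  intro h
  have := charZero_of_algebra K L
  have hsub := sub_ne_zero.2 hne
  rw [critPoly_eq hd, h] at h₁ h₂
  simp only [C_0, zero_mul, zero_add, map_add, map_mul, aeval_C, aeval_X] at h₁ h₂
  have e1 : algebraMap K L (2 * (p.coeff 2 * q.coeff 0 - p.coeff 0 * q.coeff 2)) = 0 := by
    apply mul_left_cancel₀ hsub
    rw [map_mul (algebraMap K L)]
    linear_combination h₁ - h₂
  have e1' : p.coeff 2 * q.coeff 0 - p.coeff 0 * q.coeff 2 = 0 := by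
    simpa using (map_eq_zero (algebraMap K L)).1 e1
  exact quadResultant_ne_zero hpq hd (by rw [h, e1']; ring)

/-- The resultant of `q` and `p` in terms of the values of `q` at the roots of `p`. -/
theorem val_resultant {p q : K[X]} (v : Valuation L Γ) (hp : p.natDegree = 2) {α₁ α₂ : L}
    (hfac : p.map (algebraMap K L) = C (algebraMap K L p.leadingCoeff) * ((X - C α₁) * (X - C α₂)))
    (hlc : v (algebraMap K L p.leadingCoeff) = 1) :
    v (algebraMap K L (resultant q p)) = v (aeval α₁ q * aeval α₂ q) := by
  have hp0 : p ≠ 0 := by rintro rfl; simp at hp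
  have hl : algebraMap K L p.leadingCoeff ≠ 0 := by simpa using hp0
  have hX : (X - C α₁) * (X - C α₂) ≠ 0 := mul_ne_zero (X_sub_C_ne_zero _) (X_sub_C_ne_zero _)
  have hroots : (p.map (algebraMap K L)).roots = {α₁, α₂} := by
    rw [hfac, roots_C_mul _ hl, roots_mul hX, roots_X_sub_C, roots_X_sub_C]
    rfl
  have hsplit : (p.map (algebraMap K L)).Splits := by
    rw [hfac]
    exact (Splits.C _).mul ((Splits.X_sub_C _).mul (Splits.X_sub_C _))
  have h := resultant_eq_prod_eval (p.map (algebraMap K L)) (q.map (algebraMap K L)) q.natDegree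
    (natDegree_map_le) hsplit
  rw [hroots, natDegree_map, leadingCoeff_map] at h
  rw [← resultant_map_map, resultant_comm, h]
  simp only [map_mul, map_pow, Valuation.map_neg, map_one, one_pow, one_mul, hlc]
  simp [eval_map_algebraMap]

variable [CharZero K]

/-- Under the unit conditions on `ℓ(p)`, `ℓ(c)`, `Res(q, p)` and `Disc(p)` there are local
coordinates. In them the critical points satisfy `(U γᵢ + V)² = q(α₁) q(α₂)`, so `p(γᵢ)` is a unit,
and `p_{n+1}(γᵢ)` has the same value as the form `P_n` at `(1, q(γᵢ) / p(γᵢ))`. -/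
theorem exists_unitModel [IsAlgClosed L] {p q : K[X]} (hpq : IsCoprime p q) (hd : deg p q = 2)
    (v : Valuation L Γ) (h2 : p.coeff 2 ≠ 0) {γ₁ γ₂ : L} (hne : γ₁ ≠ γ₂)
    (h₁ : aeval γ₁ (critPoly p q) = 0) (h₂ : aeval γ₂ (critPoly p q) = 0)
    (hq₁ : aeval γ₁ q ≠ 0) (hq₂ : aeval γ₂ q ≠ 0)
    (hlc : v (algebraMap K L p.leadingCoeff) = 1)
    (hc : v (algebraMap K L (critPoly p q).leadingCoeff) = 1)
    (hres : v (algebraMap K L (resultant q p)) = 1)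
    (hdisc : v (algebraMap K L p.discr) = 1) :
    ∃ M : UnitModel p q v, (∃ e : K, algebraMap K L e = aeval γ₁ q * aeval γ₂ q) ∧
      ∀ n, v (aeval γ₁ (iterNum p q (n + 1))) =
          v ((liftMap p q)^[n] (1, algebraMap K L M.Q + M.ψ₁)).1 ∧
        v (aeval γ₂ (iterNum p q (n + 1))) =
          v ((liftMap p q)^[n] (1, algebraMap K L M.Q + M.ψ₂)).1 := by
  have := charZero_of_algebra K L
  obtain ⟨hp, hq⟩ := natDegree_le_of_deg hd
  have hpdeg : p.natDegree = 2 := natDegree_eq_of_le_of_coeff_ne_zero hp h2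
  have hlead : p.leadingCoeff = p.coeff 2 := by rw [leadingCoeff, hpdeg]
  have hc2 := coeff_two_critPoly_ne_zero hpq hd hne h₁ h₂
  rw [leadingCoeff_critPoly hd hc2] at hc
  -- the coordinates
  obtain ⟨Q, hQ⟩ : ∃ Q, q.coeff 2 = Q * p.coeff 2 := ⟨q.coeff 2 / p.coeff 2, by field_simp⟩
  obtain ⟨U, hU⟩ : ∃ U, q.coeff 1 = Q * p.coeff 1 + U := ⟨_, (add_sub_cancel _ _).symm⟩
  obtain ⟨V, hV⟩ : ∃ V, q.coeff 0 = Q * p.coeff 0 + V := ⟨_, (add_sub_cancel _ _).symm⟩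
  have h2' : algebraMap K L (p.coeff 2) ≠ 0 := by simpa using h2
  obtain ⟨α₁, hα₁⟩ : ∃ α : L, aeval α p = 0 :=
    IsAlgClosed.exists_aeval_eq_zero L p (by
      rw [degree_eq_natDegree (ne_zero_of_coeff_ne_zero h2), hpdeg]; norm_num)
  rw [aeval_eq_form hp] at hα₁
  simp only [form] at hα₁
  obtain ⟨α₂, hα₂⟩ : ∃ α₂ : L,
      algebraMap K L (p.coeff 1) = -(algebraMap K L (p.coeff 2) * (α₁ + α₂)) :=
    ⟨-(algebraMap K L (p.coeff 1) / algebraMap K L (p.coeff 2)) - α₁, by field_simp; ring⟩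
  have hα₀ : algebraMap K L (p.coeff 0) = algebraMap K L (p.coeff 2) * (α₁ * α₂) := by
    rw [hα₂] at hα₁; linear_combination hα₁
  have hval_a : v (algebraMap K L (p.coeff 2)) = 1 := hlead ▸ hlc
  have hval_U : v (algebraMap K L U) = 1 := by
    have e : p.coeff 2 * q.coeff 1 - p.coeff 1 * q.coeff 2 = p.coeff 2 * U := by
      rw [hU, hQ]; ring
    rw [e, map_mul, map_mul, hval_a, one_mul] at hc
    exact hc
  have hU0 : algebraMap K L U ≠ 0 := by
    intro e; rw [e, map_zero] at hval_U; exact zero_ne_one hval_U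
  have hval_α : v (α₁ - α₂) = 1 := by
    have e : algebraMap K L p.discr = algebraMap K L (p.coeff 2) ^ 2 * (α₁ - α₂) ^ 2 := by
      rw [discr_of_degree_eq_two (by
        rw [degree_eq_natDegree (ne_zero_of_coeff_ne_zero h2), hpdeg]; rfl)]
      simp only [map_sub, map_mul, map_pow, map_ofNat]
      rw [hα₂, hα₀]; ring
    rw [e, map_mul, map_pow, hval_a, one_pow, one_mul, sq] at hdisc
    exact (val_pair_eq_one v hdisc (by simp)).1
  -- values of `p` and `q` in the new coordinates
  have hpx : ∀ x : L, aeval x p = algebraMap K L (p.coeff 2) * ((x - α₁) * (x - α₂)) := by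
    intro x
    rw [aeval_eq_form hp]; simp only [form]
    rw [hα₂, hα₀]; ring
  have hqx : ∀ x : L, aeval x q =
      algebraMap K L Q * aeval x p + (algebraMap K L U * x + algebraMap K L V) := by
    intro x
    rw [aeval_eq_form hp, aeval_eq_form hq]; simp only [form]
    rw [hQ, hU, hV]; simp only [map_add, map_mul]; ring
  set ρ₁ := algebraMap K L U * α₁ + algebraMap K L V with hρ₁
  set ρ₂ := algebraMap K L U * α₂ + algebraMap K L V with hρ₂
  have hfac : p.map (algebraMap K L) =
      C (algebraMap K L p.leadingCoeff) * ((X - C α₁) * (X - C α₂)) := by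
    rw [hlead, eq_of_natDegree_le_two hp]
    simp only [Polynomial.map_add, Polynomial.map_mul, Polynomial.map_pow, map_C, map_X, hα₂, hα₀,
      coeff_add, coeff_C_mul, coeff_C, coeff_X, coeff_X_pow]
    simp
    ring
  have hρρ : v (ρ₁ * ρ₂) = 1 := by
    rw [val_resultant v hpdeg hfac hlc, hqx, hqx, hpx, hpx] at hres
    simpa using hres
  have hρd : v (ρ₁ - ρ₂) = 1 := by
    rw [show ρ₁ - ρ₂ = algebraMap K L U * (α₁ - α₂) by rw [hρ₁, hρ₂]; ring, map_mul, hval_U,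
      hval_α, one_mul]
  obtain ⟨hv₁, hv₂⟩ := val_pair_eq_one v hρρ hρd.le
  -- the critical points satisfy `(U γ + V)² = ρ₁ ρ₂`
  have hg : ∀ γ : L, aeval γ (critPoly p q) = 0 →
      (algebraMap K L U * γ + algebraMap K L V) ^ 2 = ρ₁ * ρ₂ := by
    intro γ hγ
    rw [critPoly_eq hd] at hγ
    simp only [map_add, map_mul, map_sub, map_pow, aeval_C, aeval_X, hQ, hU, hV, map_ofNat,
      hα₂, hα₀] at hγ
    rw [hρ₁, hρ₂]
    apply mul_left_cancel₀ h2'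
    linear_combination algebraMap K L U * hγ
  have hg₁ := hg γ₁ h₁
  have hg₂ := hg γ₂ h₂
  have hneg : algebraMap K L U * γ₂ + algebraMap K L V =
      -(algebraMap K L U * γ₁ + algebraMap K L V) := by
    rcases sq_eq_sq_iff_eq_or_eq_neg.1 (hg₂.trans hg₁.symm) with e | e
    · exact absurd (mul_left_cancel₀ hU0 (add_right_cancel e)).symm hne
    · exact e
  set g := algebraMap K L U * γ₁ + algebraMap K L V with hgdef
  have hvg : v g = 1 := by
    have := congrArg v hg₁
    rw [hρρ, sq] at this
    exact (val_pair_eq_one v this (by simp)).1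
  have hvd : v (2 * g - (ρ₁ + ρ₂)) = 1 ∧ v (-(2 * g) - (ρ₁ + ρ₂)) = 1 := by
    have hv2 : v (2 : L) ≤ 1 := by simpa using val_natCast_le_one v 2
    have h2g := val_le_one_mul v hv2 hvg.le
    have hs : v (ρ₁ + ρ₂) ≤ 1 := (Valuation.map_add v _ _).trans (max_le hv₁.le hv₂.le)
    have hprod : v ((2 * g - (ρ₁ + ρ₂)) * (-(2 * g) - (ρ₁ + ρ₂))) = 1 := by
      rw [show (2 * g - (ρ₁ + ρ₂)) * (-(2 * g) - (ρ₁ + ρ₂)) = (ρ₁ - ρ₂) ^ 2 by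
        linear_combination -4 * hg₁, map_pow, hρd, one_pow]
    have i₁ := val_le_one_sub v h2g hs
    have i₂ := val_le_one_sub v (x := -(2 * g)) (by rwa [Valuation.map_neg]) hs
    exact ⟨val_eq_one_of_mul v i₁ i₂ hprod, val_eq_one_of_mul v i₂ i₁ (by rwa [mul_comm])⟩
  have hpγ : ∀ γ h : L, algebraMap K L U * γ + algebraMap K L V = h → h ^ 2 = ρ₁ * ρ₂ →
      algebraMap K L U ^ 2 * aeval γ p =
        algebraMap K L (p.coeff 2) * (h * (2 * h - (ρ₁ + ρ₂))) := by
    intro γ h hh hsq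
    rw [hpx]
    rw [← hh] at hsq ⊢
    rw [hρ₁, hρ₂] at hsq ⊢
    linear_combination -algebraMap K L (p.coeff 2) * hsq
  have hp₁ := hpγ γ₁ g rfl hg₁
  have hp₂ := hpγ γ₂ (-g) hneg (by rw [neg_sq]; exact hg₁)
  have hvp₁ : v (aeval γ₁ p) = 1 := by
    have := congrArg v hp₁
    simpa [map_mul, hval_U, hval_a, hvg, hvd.1] using this
  have hvp₂ : v (aeval γ₂ p) = 1 := by
    have := congrArg v hp₂
    rw [mul_neg] at this
    simpa [map_mul, hval_U, hval_a, hvg, hvd.2, Valuation.map_neg] using this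
  have hp0 : ∀ {x : L}, v x = 1 → x ≠ 0 := fun h e => by simp [e] at h
  have hτ₁ : aeval γ₁ q = aeval γ₁ p * (algebraMap K L Q + g / aeval γ₁ p) := by
    have := hp0 hvp₁
    rw [hqx γ₁, ← hgdef]; field_simp
  have hτ₂ : aeval γ₂ q = aeval γ₂ p * (algebraMap K L Q + -g / aeval γ₂ p) := by
    have := hp0 hvp₂
    rw [hqx γ₂, hneg]; field_simp
  have horbit : ∀ (γ τ : L), v (aeval γ p) = 1 → aeval γ q = aeval γ p * τ → ∀ n,
      v (aeval γ (iterNum p q (n + 1))) = v ((liftMap p q)^[n] (1, τ)).1 := by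
    intro γ τ hv hτ n
    rw [aeval_iterNum_succ hd, hτ]
    have : (aeval γ p, aeval γ p * τ) = aeval γ p • ((1 : L), τ) := by simp
    rw [this, liftMap_iterate_smul, Prod.smul_fst, smul_eq_mul, map_mul, map_pow, hv, one_pow,
      one_mul]
  have hdiscr : ∀ t : L, fiberDisc p q t = fiberDisc p q 0 *
      ((1 - t * (algebraMap K L Q + g / aeval γ₁ p)) *
        (1 - t * (algebraMap K L Q + -g / aeval γ₂ p))) := by
    obtain ⟨c, -, hcδ⟩ := fiberDisc_eq_mul (L := L) hpq hd
      (γ₁ := (γ₁ : OnePoint L)) (γ₂ := (γ₂ : OnePoint L)) (by simpa using hne) h₁ h₂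
      (ratMap_coe_eq_coe.2 ⟨hq₁, rfl⟩) (ratMap_coe_eq_coe.2 ⟨hq₂, rfl⟩)
    intro t
    rw [hcδ, hcδ]
    have e₁ : algebraMap K L Q + g / aeval γ₁ p = aeval γ₁ q / aeval γ₁ p := by
      rw [hτ₁, mul_div_cancel_left₀ _ (hp0 hvp₁)]
    have e₂ : algebraMap K L Q + -g / aeval γ₂ p = aeval γ₂ q / aeval γ₂ p := by
      rw [hτ₂, mul_div_cancel_left₀ _ (hp0 hvp₂)]
    rw [e₁, e₂]
    have := hp0 hvp₁
    have := hp0 hvp₂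
    field_simp
    ring
  refine ⟨⟨p.coeff 2, U, V, Q, α₁, α₂, g / aeval γ₁ p, -g / aeval γ₂ p, rfl, hα₂, hα₀, hQ, hU, hV,
    hval_a, hval_U, hval_α, hv₁, hv₂, by rw [map_div₀, hvg, hvp₁, div_one],
    by rw [map_div₀, Valuation.map_neg, hvg, hvp₂, div_one], hdiscr⟩, ?_,
    fun n => ⟨horbit _ _ hvp₁ hτ₁ n, horbit _ _ hvp₂ hτ₂ n⟩⟩
  -- the norm of `q(γ)` is symmetric in the critical points, hence lies in `K`
  have hUK : U ≠ 0 := by rintro rfl; simp at hU0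
  obtain ⟨s, hs⟩ : ∃ s : K, algebraMap K L s = ρ₁ + ρ₂ :=
    ⟨2 * V - U * p.coeff 1 / p.coeff 2, by
      simp only [map_sub, map_mul, map_div₀, map_ofNat]
      rw [hα₂, hρ₁, hρ₂]; field_simp; ring⟩
  obtain ⟨t, ht⟩ : ∃ t : K, algebraMap K L t = ρ₁ * ρ₂ :=
    ⟨V ^ 2 - U * V * p.coeff 1 / p.coeff 2 + U ^ 2 * p.coeff 0 / p.coeff 2, by
      simp only [map_sub, map_add, map_mul, map_pow, map_div₀]
      rw [hα₂, hα₀, hρ₁, hρ₂]; field_simp; ring⟩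
  refine ⟨-t * ((1 - Q * p.coeff 2 / U ^ 2 * s) ^ 2 - 4 * (Q * p.coeff 2 / U ^ 2) ^ 2 * t), ?_⟩
  have f₁ : aeval γ₁ q =
      g * (1 + algebraMap K L (Q * p.coeff 2 / U ^ 2) * (2 * g - (ρ₁ + ρ₂))) := by
    rw [hqx, ← hgdef]
    simp only [map_mul, map_div₀, map_pow]
    field_simp
    linear_combination algebraMap K L Q * hp₁
  have f₂ : aeval γ₂ q =
      -g * (1 + algebraMap K L (Q * p.coeff 2 / U ^ 2) * (2 * -g - (ρ₁ + ρ₂))) := by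
    rw [hqx, hneg]
    simp only [map_mul, map_div₀, map_pow]
    field_simp
    linear_combination algebraMap K L Q * hp₂
  rw [f₁, f₂]
  generalize Q * p.coeff 2 / U ^ 2 = κ
  simp only [map_sub, map_mul, map_neg, map_pow, map_one, map_ofNat]
  rw [hs, ht, ← hg₁]
  ring

end UnitModel
end RatDyn

/-! ### Ramification in the tower -/

namespace RatDyn

section Reduction

variable {K : Type*} [Field K] {L : Type*} [Field L] [Algebra K L]
  {Γ : Type*} [LinearOrderedCommGroupWithZero Γ] (v : Valuation L Γ)

theorem val_mul_lt_one {x y : L} (hx : v x < 1) (hy : v y ≤ 1) : v (x * y) < 1 := by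
  rw [map_mul]; exact mul_lt_one_of_lt_of_le hx hy

theorem val_add_le_one {x y : L} (hx : v x ≤ 1) (hy : v y ≤ 1) : v (x + y) ≤ 1 :=
  (Valuation.map_add v x y).trans (max_le hx hy)

theorem val_form_le_one {f : K[X]} (hf : ∀ i, i ≤ 2 → v (algebraMap K L (f.coeff i)) ≤ 1)
    {w : L × L} (h₁ : v w.1 ≤ 1) (h₂ : v w.2 ≤ 1) : v (form f w) ≤ 1 := by
  unfold form
  refine val_add_le_one v (val_add_le_one v ?_ ?_) ?_ <;>
    refine val_le_one_mul v (hf _ (by norm_num)) ?_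
  · rw [map_pow]; exact pow_le_one' h₁ 2
  · exact val_le_one_mul v h₁ h₂
  · rw [map_pow]; exact pow_le_one' h₂ 2

theorem val_form_sub_lt_one {f : K[X]} (hf : ∀ i, i ≤ 2 → v (algebraMap K L (f.coeff i)) ≤ 1)
    {w w' : L × L} (h₁ : v w.1 ≤ 1) (h₂ : v w.2 ≤ 1) (h₁' : v w'.1 ≤ 1) (h₂' : v w'.2 ≤ 1)
    (hd₁ : v (w.1 - w'.1) < 1) (hd₂ : v (w.2 - w'.2) < 1) : v (form f w - form f w') < 1 := by
  have e : form f w - form f w' =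
      (w.1 - w'.1) * (algebraMap K L (f.coeff 2) * (w.1 + w'.1) +
        algebraMap K L (f.coeff 1) * w.2) +
      (w.2 - w'.2) * (algebraMap K L (f.coeff 1) * w'.1 +
        algebraMap K L (f.coeff 0) * (w.2 + w'.2)) := by
    unfold form; ring
  rw [e]
  refine (Valuation.map_add v _ _).trans_lt (max_lt ?_ ?_)
  · exact val_mul_lt_one v hd₁ (val_add_le_one v
      (val_le_one_mul v (hf _ (by norm_num)) (val_add_le_one v h₁ h₁'))
      (val_le_one_mul v (hf _ (by norm_num)) h₂))
  · exact val_mul_lt_one v hd₂ (val_add_le_one v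
      (val_le_one_mul v (hf _ (by norm_num)) h₁')
      (val_le_one_mul v (hf _ (by norm_num)) (val_add_le_one v h₂ h₂')))

/-- An integral lift preserves congruence modulo the maximal ideal. -/
theorem val_liftMap_iterate_sub_lt_one {p q : K[X]}
    (hp : ∀ i, i ≤ 2 → v (algebraMap K L (p.coeff i)) ≤ 1)
    (hq : ∀ i, i ≤ 2 → v (algebraMap K L (q.coeff i)) ≤ 1) (n : ℕ)
    {w w' : L × L} (h₁ : v w.1 ≤ 1) (h₂ : v w.2 ≤ 1) (h₁' : v w'.1 ≤ 1) (h₂' : v w'.2 ≤ 1)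
    (hd₁ : v (w.1 - w'.1) < 1) (hd₂ : v (w.2 - w'.2) < 1) :
    v (((liftMap p q)^[n] w).1 - ((liftMap p q)^[n] w').1) < 1 := by
  induction n generalizing w w' with
  | zero => exact hd₁
  | succ n ih =>
    rw [Function.iterate_succ_apply, Function.iterate_succ_apply]
    exact ih (val_form_le_one v hp h₁ h₂) (val_form_le_one v hq h₁ h₂)
      (val_form_le_one v hp h₁' h₂') (val_form_le_one v hq h₁' h₂')
      (val_form_sub_lt_one v hp h₁ h₂ h₁' h₂' hd₁ hd₂)
      (val_form_sub_lt_one v hq h₁ h₂ h₁' h₂' hd₁ hd₂)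

/-- For integral `p` and `q`, if the form `P_k` does not vanish at `(1 : τ)` modulo the maximal
ideal, then no root `α` of `p_k` reduces to `τ⁻¹`. The scaling factor `y` makes the homogeneous
coordinates `(y α : y)` of `α` integral and coprime. -/
theorem exists_val_mul_one_sub_eq_one {p q : K[X]} (hd : deg p q = 2)
    (hp : ∀ i, i ≤ 2 → v (algebraMap K L (p.coeff i)) ≤ 1)
    (hq : ∀ i, i ≤ 2 → v (algebraMap K L (q.coeff i)) ≤ 1) {k : ℕ} {α : L}
    (hα : aeval α (iterNum p q k) = 0) :
    ∃ y : L, (y = 1 ∨ y = α⁻¹) ∧ y ≠ 0 ∧ v y ≤ 1 ∧ v (y * α) ≤ 1 ∧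
      ∀ τ, v τ ≤ 1 → v ((liftMap p q)^[k] (1, τ)).1 = 1 → v (y * (1 - α * τ)) = 1 := by
  rw [aeval_iterNum hd] at hα
  rcases le_or_gt (v α) 1 with h | h
  · refine ⟨1, Or.inl rfl, one_ne_zero, by simp, by simpa using h, fun τ hτ hk => ?_⟩
    rw [one_mul]
    have hατ := val_le_one_mul v h hτ
    refine le_antisymm (val_le_one_sub v (by simp) hατ) (not_lt.1 fun hlt => ?_)
    have hα1 : v α = 1 := by
      refine val_eq_one_of_mul v h hτ ?_
      rw [show α * τ = 1 - (1 - α * τ) by ring, ← map_one v]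
      exact Valuation.map_sub_eq_of_lt_left v (hlt.trans_eq (map_one v).symm)
    have hcong := val_liftMap_iterate_sub_lt_one v hp hq k (w := (α, 1)) (w' := (α, α * τ))
      h (by simp) h hατ (by simp) hlt
    have hsmul : (α, α * τ) = α • ((1 : L), τ) := by simp
    rw [hα, hsmul, liftMap_iterate_smul, Prod.smul_fst, zero_sub, Valuation.map_neg, smul_eq_mul,
      map_mul, map_pow, hα1, one_pow, one_mul, hk] at hcong
    exact lt_irrefl _ hcong
  · have hα0 : α ≠ 0 := by rintro rfl; simp at h
    have hinv : v α⁻¹ < 1 := by rw [map_inv₀]; exact inv_lt_one_of_one_lt₀ h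
    refine ⟨α⁻¹, Or.inr rfl, inv_ne_zero hα0, hinv.le, by simp [hα0], fun τ hτ hk => ?_⟩
    rw [show α⁻¹ * (1 - α * τ) = α⁻¹ - τ by field_simp]
    refine le_antisymm (val_le_one_sub v hinv.le hτ) (not_lt.1 fun hlt => ?_)
    have hcong := val_liftMap_iterate_sub_lt_one v hp hq k (w := (1, α⁻¹)) (w' := (1, τ))
      (by simp) hinv.le (by simp) hτ (by simp) hlt
    have hsmul : (α, (1 : L)) = α • ((1 : L), α⁻¹) := by simp [hα0]
    rw [hsmul, liftMap_iterate_smul, Prod.smul_fst, smul_eq_mul, mul_eq_zero] at hα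
    rw [hα.resolve_left (pow_ne_zero _ hα0), zero_sub, Valuation.map_neg, hk] at hcong
    exact lt_irrefl _ hcong

end Reduction

section Ramification

open IntermediateField

variable {K : Type*} [Field K]
  {Γ : Type*} [LinearOrderedCommGroupWithZero Γ] {v : Valuation (AlgebraicClosure K) Γ}

theorem valuesIn_iterField_zero (p q : K[X]) : ValuesIn v (iterField p q 0) := by
  have : iterField p q 0 = ⊥ := by
    rw [iterField, iterNum_zero, eq_bot_iff, adjoin_le_iff]
    intro x hx
    have : x = 0 := by simpa using (mem_rootSet.1 hx).2
    rw [this]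
    exact zero_mem _
  intro z hz
  rw [this, mem_bot] at hz
  obtain ⟨c, rfl⟩ := hz
  exact ⟨c, rfl⟩

namespace UnitModel

variable {p q : K[X]}

theorem val_fiberDisc_zero (M : UnitModel p q v) :
    v (fiberDisc p q (0 : AlgebraicClosure K)) = 1 := by
  have e : fiberDisc p q (0 : AlgebraicClosure K) =
      algebraMap K (AlgebraicClosure K) M.a ^ 2 * (M.α₁ - M.α₂) ^ 2 := by
    simp only [fiberDisc, zero_mul, sub_zero, M.p_two, M.p_one, M.p_zero]
    ring
  rw [e, map_mul, map_pow, map_pow, M.val_a, M.val_α]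
  simp

variable (M : UnitModel p q v)

theorem form_p (w : AlgebraicClosure K × AlgebraicClosure K) :
    form p w = algebraMap K (AlgebraicClosure K) M.a *
      ((w.1 - M.α₁ * w.2) * (w.1 - M.α₂ * w.2)) := by
  rw [form, M.p_two, M.p_one, M.p_zero]
  ring

theorem form_q (w : AlgebraicClosure K × AlgebraicClosure K) :
    form q w = algebraMap K (AlgebraicClosure K) M.Q * form p w +
      (algebraMap K (AlgebraicClosure K) M.U * w.1 +
        algebraMap K (AlgebraicClosure K) M.V * w.2) * w.2 := by
  rw [form, form, M.q_two, M.q_one, M.q_zero]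
  simp only [map_mul, map_add]
  ring

/-- The roots of `p_1` are `α₁` and `α₂`. -/
theorem root_cases (hd : deg p q = 2) {α : AlgebraicClosure K}
    (hα : aeval α (iterNum p q 1) = 0) : α = M.α₁ ∨ α = M.α₂ := by
  rw [aeval_iterNum hd, Function.iterate_one, liftMap, M.form_p] at hα
  have ha : algebraMap K (AlgebraicClosure K) M.a ≠ 0 := fun e => by
    have := M.val_a
    simp [e] at this
  have : (α - M.α₁) * (α - M.α₂) = 0 := by simpa [ha] using hα
  simpa [sub_eq_zero] using this

theorem val_V_Q_le_one
    (h₁ : v ((liftMap p q)^[1]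
      (1, algebraMap K (AlgebraicClosure K) M.Q + M.ψ₁)).1 = 1)
    (h₂ : v ((liftMap p q)^[2]
      (1, algebraMap K (AlgebraicClosure K) M.Q + M.ψ₁)).1 = 1) :
    v (algebraMap K (AlgebraicClosure K) M.V) ≤ 1 ∧
      v (algebraMap K (AlgebraicClosure K) M.Q) ≤ 1 := by
  refine val_le_one_of_orbit v M.val_a M.val_U M.val_α M.val_ρ₁ M.val_ρ₂ M.val_ψ₁
    (X₁ := form p (1, algebraMap K (AlgebraicClosure K) M.Q + M.ψ₁))
    (Y₁ := form q (1, algebraMap K (AlgebraicClosure K) M.Q + M.ψ₁))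
    (M.form_p _) (by rw [M.form_q, mul_one]) h₁ ?_
  have : v (form p (form p ((1 : AlgebraicClosure K), algebraMap K (AlgebraicClosure K) M.Q + M.ψ₁),
      form q ((1 : AlgebraicClosure K), algebraMap K (AlgebraicClosure K) M.Q + M.ψ₁))) = 1 := h₂
  rw [M.form_p, map_mul, M.val_a, one_mul] at this
  exact this

theorem val_coeff_le_one (hV : v (algebraMap K (AlgebraicClosure K) M.V) ≤ 1)
    (hQ : v (algebraMap K (AlgebraicClosure K) M.Q) ≤ 1) :
    (∀ i, i ≤ 2 → v (algebraMap K (AlgebraicClosure K) (p.coeff i)) ≤ 1) ∧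
      ∀ i, i ≤ 2 → v (algebraMap K (AlgebraicClosure K) (q.coeff i)) ≤ 1 := by
  have hα : ∀ α, v (algebraMap K (AlgebraicClosure K) M.U * α +
      algebraMap K (AlgebraicClosure K) M.V) = 1 → v α ≤ 1 := by
    intro α hρ
    have := val_le_one_sub v hρ.le hV
    rwa [add_sub_cancel_right, map_mul, M.val_U, one_mul] at this
  have h₁ := hα _ M.val_ρ₁
  have h₂ := hα _ M.val_ρ₂
  have hp : ∀ i, i ≤ 2 → v (algebraMap K (AlgebraicClosure K) (p.coeff i)) ≤ 1 := by
    intro i hi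
    interval_cases i
    · rw [M.p_zero]
      exact val_le_one_mul v M.val_a.le (val_le_one_mul v h₁ h₂)
    · rw [M.p_one, Valuation.map_neg]
      exact val_le_one_mul v M.val_a.le (val_add_le_one v h₁ h₂)
    · rw [M.p_two, M.val_a]
  refine ⟨hp, fun i hi => ?_⟩
  interval_cases i
  · rw [M.q_zero, map_add, map_mul]
    exact val_add_le_one v (val_le_one_mul v hQ (hp 0 hi)) hV
  · rw [M.q_one, map_add, map_mul]
    exact val_add_le_one v (val_le_one_mul v hQ (hp 1 hi)) M.val_U.le
  · rw [M.q_two, map_mul]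
    exact val_le_one_mul v hQ (hp 2 hi)

/-- The unit conditions up to level `m`: the forms `P_k` with `k ≤ m` take unit values at the
points `(1 : q(γᵢ) / p(γᵢ))`. -/
def UnitOrbit (m : ℕ) : Prop :=
  ∀ k ≤ m, v ((liftMap p q)^[k] (1, algebraMap K (AlgebraicClosure K) M.Q + M.ψ₁)).1 = 1 ∧
    v ((liftMap p q)^[k] (1, algebraMap K (AlgebraicClosure K) M.Q + M.ψ₂)).1 = 1

variable {M}

theorem UnitOrbit.mono {m k : ℕ} (h : M.UnitOrbit m) (hk : k ≤ m) : M.UnitOrbit k :=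
  fun j hj => h j (hj.trans hk)

/-- Once `p` and `q` are integral, the unit conditions make `P - α Q` separable modulo the
maximal ideal, after scaling to integral coprime coordinates. -/
theorem exists_val_scaled_fiberDisc_eq_one (hd : deg p q = 2)
    (hV : v (algebraMap K (AlgebraicClosure K) M.V) ≤ 1)
    (hQ : v (algebraMap K (AlgebraicClosure K) M.Q) ≤ 1) {k : ℕ} (h : M.UnitOrbit k)
    {α : AlgebraicClosure K} (hα : aeval α (iterNum p q k) = 0) :
    ∃ y, (y = 1 ∨ y = α⁻¹) ∧ y ≠ 0 ∧ v y ≤ 1 ∧ v (y * α) ≤ 1 ∧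
      v (y ^ 2 * fiberDisc p q α) = 1 := by
  obtain ⟨hp, hq⟩ := M.val_coeff_le_one hV hQ
  obtain ⟨y, hy, hy0, hyv, hyα, hτ⟩ := exists_val_mul_one_sub_eq_one v hd hp hq hα
  refine ⟨y, hy, hy0, hyv, hyα, ?_⟩
  have e₁ := hτ _ (val_add_le_one v hQ M.val_ψ₁.le) (h k le_rfl).1
  have e₂ := hτ _ (val_add_le_one v hQ M.val_ψ₂.le) (h k le_rfl).2
  rw [M.fiberDisc_eq, map_mul, map_mul, M.val_fiberDisc_zero, one_mul, ← map_mul,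
    show ∀ x z : AlgebraicClosure K, y ^ 2 * (x * z) = (y * x) * (y * z) by intros; ring,
    map_mul, e₁, e₂, one_mul]

theorem aeval_iterNum_zero {α : AlgebraicClosure K} (hα : aeval α (iterNum p q 0) = 0) :
    α = 0 := by simpa [iterNum_zero] using hα

/-- From level two on, the unit conditions force `p` and `q` to be integral. -/
theorem UnitOrbit.val_V_Q_le_one {m : ℕ} (hm : 2 ≤ m) (h : M.UnitOrbit m) :
    v (algebraMap K (AlgebraicClosure K) M.V) ≤ 1 ∧
      v (algebraMap K (AlgebraicClosure K) M.Q) ≤ 1 :=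
  M.val_V_Q_le_one (h 1 (by omega)).1 (h 2 hm).1

variable [CharZero K]

/-- Adjoining the square root of the discriminant of `P - α Q` does not enlarge the value
group. -/
theorem exists_val_add_mul_sqrtDisc_eq (hd : deg p q = 2) {k : ℕ}
    (h' : (iterNum p q (k + 1)).coeff (2 ^ (k + 1)) ≠ 0)
    (hint : k = 0 ∨ v (algebraMap K (AlgebraicClosure K) M.V) ≤ 1 ∧
      v (algebraMap K (AlgebraicClosure K) M.Q) ≤ 1) (h : M.UnitOrbit k)
    {α : AlgebraicClosure K} (hα : aeval α (iterNum p q k) = 0)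
    (E : IntermediateField K (AlgebraicClosure K)) (hαE : α ∈ E)
    {d e : AlgebraicClosure K} (he : e ∈ E) (hdE : d ∈ E) :
    ∃ f ∈ E, v (e + d * sqrtDisc p q α) = v f := by
  obtain ⟨β, hβ, hs⟩ := exists_mem_fiber hd (coeff_two_sub_ne_zero hd h' hα)
  have hK : ∀ c : K, algebraMap K (AlgebraicClosure K) c ∈ E := fun c => E.algebraMap_mem c
  have hs2 : v (sqrtDisc p q α) ^ 2 = v (fiberDisc p q α) := by rw [← map_pow, sqrtDisc_sq]
  have hroot := fiber_quadratic hd hβ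
  unfold fiberDeriv at hs
  rcases hint with rfl | ⟨hV, hQ⟩
  · -- the element `U β + V` satisfies a monic quadratic with unit discriminant
    obtain rfl := aeval_iterNum_zero hα
    simp only [zero_mul, sub_zero] at hs hroot
    have ha0 : algebraMap K (AlgebraicClosure K) M.a ≠ 0 := fun e => by
      have := M.val_a
      simp [e] at this
    have hU0 : algebraMap K (AlgebraicClosure K) M.U ≠ 0 := fun e => by
      have := M.val_U
      simp [e] at this
    rw [M.val_fiberDisc_zero, sq, ← map_mul] at hs2
    have hsv := (val_pair_eq_one v hs2 (by simp)).1
    have hB : -((algebraMap K (AlgebraicClosure K) M.U * M.α₁ +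
        algebraMap K (AlgebraicClosure K) M.V) + (algebraMap K (AlgebraicClosure K) M.U * M.α₂ +
        algebraMap K (AlgebraicClosure K) M.V)) =
        algebraMap K (AlgebraicClosure K) (M.U * p.coeff 1 / M.a - 2 * M.V) := by
      simp only [map_sub, map_mul, map_div₀, map_ofNat]
      rw [M.p_one]; field_simp; ring
    have hC : (algebraMap K (AlgebraicClosure K) M.U * M.α₁ +
        algebraMap K (AlgebraicClosure K) M.V) * (algebraMap K (AlgebraicClosure K) M.U * M.α₂ +
        algebraMap K (AlgebraicClosure K) M.V) = algebraMap K (AlgebraicClosure K)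
          (M.V ^ 2 - M.U * M.V * p.coeff 1 / M.a + M.U ^ 2 * p.coeff 0 / M.a) := by
      simp only [map_sub, map_add, map_mul, map_pow, map_div₀]
      rw [M.p_one, M.p_zero]; field_simp; ring
    rw [M.p_two, M.p_one] at hs
    rw [M.p_two, M.p_one, M.p_zero] at hroot
    have hder : 2 * 1 * (algebraMap K (AlgebraicClosure K) M.U * β +
        algebraMap K (AlgebraicClosure K) M.V) +
        -((algebraMap K (AlgebraicClosure K) M.U * M.α₁ +
        algebraMap K (AlgebraicClosure K) M.V) + (algebraMap K (AlgebraicClosure K) M.U * M.α₂ +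
        algebraMap K (AlgebraicClosure K) M.V)) =
        algebraMap K (AlgebraicClosure K) M.U / algebraMap K (AlgebraicClosure K) M.a *
          sqrtDisc p q (0 : AlgebraicClosure K) := by
      rw [← hs]; field_simp; ring
    have key := exists_val_add_mul_deriv_eq v E (A := 1) (one_mem _) (hB ▸ hK _) (hC ▸ hK _)
      (by simp) (by rw [map_mul, M.val_ρ₁, M.val_ρ₂, one_mul])
      (β := algebraMap K (AlgebraicClosure K) M.U * β + algebraMap K (AlgebraicClosure K) M.V)
      (by
        apply mul_left_cancel₀ ha0
        linear_combination algebraMap K (AlgebraicClosure K) M.U ^ 2 * hroot)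
      (by rw [hder, map_mul, map_div₀, M.val_U, M.val_a, hsv]; simp)
      (d := d * algebraMap K (AlgebraicClosure K) M.a / algebraMap K (AlgebraicClosure K) M.U)
      (e := e) (div_mem (mul_mem hdE (hK _)) (hK _)) he
    rw [hder] at key
    convert key using 5
    field_simp
  · obtain ⟨hp, hq⟩ := M.val_coeff_le_one hV hQ
    obtain ⟨y, hy, hy0, hyv, hyα, hdisc⟩ := exists_val_scaled_fiberDisc_eq_one hd hV hQ h hα
    have hyE : y ∈ E := by
      rcases hy with rfl | rfl
      · exact one_mem _
      · exact inv_mem hαE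
    have hmem : ∀ i, y * (algebraMap K (AlgebraicClosure K) (p.coeff i) -
        α * algebraMap K (AlgebraicClosure K) (q.coeff i)) ∈ E := fun i =>
      mul_mem hyE (sub_mem (hK _) (mul_mem hαE (hK _)))
    have hval : ∀ i ≤ 2, v (y * (algebraMap K (AlgebraicClosure K) (p.coeff i) -
        α * algebraMap K (AlgebraicClosure K) (q.coeff i))) ≤ 1 := fun i hi => by
      rw [mul_sub, ← mul_assoc]
      exact val_le_one_sub v (val_le_one_mul v hyv (hp i hi)) (val_le_one_mul v hyα (hq i hi))
    have hder : 2 * (y * (algebraMap K (AlgebraicClosure K) (p.coeff 2) -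
        α * algebraMap K (AlgebraicClosure K) (q.coeff 2))) * β +
        y * (algebraMap K (AlgebraicClosure K) (p.coeff 1) -
        α * algebraMap K (AlgebraicClosure K) (q.coeff 1)) = y * sqrtDisc p q α := by
      rw [← hs]; ring
    have hsv : v (y * sqrtDisc p q α) = 1 := by
      rw [map_mul, map_pow, ← hs2, ← mul_pow, ← map_mul, sq, ← map_mul] at hdisc
      exact (val_pair_eq_one v hdisc (by simp)).1
    have key := exists_val_add_mul_deriv_eq v E (hmem 2) (hmem 1) (hmem 0)
      (hval 2 le_rfl) (hval 0 (by norm_num)) (β := β) (by linear_combination y * hroot)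
      (by rw [hder, hsv]) (d := d / y) (e := e) (div_mem hdE hyE) he
    rw [hder] at key
    convert key using 5
    field_simp

/-- If `K_k` has ramification index one over `K`, then so has `K_{k+1}`, provided that the unit
conditions hold up to level `k` and that `p` and `q` are integral unless `k = 0`. -/
theorem valuesIn_iterField_succ (hpq : IsCoprime p q) (hd : deg p q = 2) {k : ℕ}
    (h₀ : (iterNum p q k).coeff (2 ^ k) ≠ 0)
    (h' : (iterNum p q (k + 1)).coeff (2 ^ (k + 1)) ≠ 0)
    (hint : k = 0 ∨ v (algebraMap K (AlgebraicClosure K) M.V) ≤ 1 ∧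
      v (algebraMap K (AlgebraicClosure K) M.Q) ≤ 1) (h : M.UnitOrbit k)
    (hval : ValuesIn v (iterField p q k)) : ValuesIn v (iterField p q (k + 1)) := by
  classical
  have hroot : ∀ {α}, α ∈ (iterNum p q k).rootSet (AlgebraicClosure K) →
      α ∈ iterField p q k := fun hα => subset_adjoin K _ hα
  have := valuesIn_sup_adjoin v (iterField p q k) hval (sqrtDisc p q)
    ((iterNum p q k).rootSet (AlgebraicClosure K)).toFinset
    (fun α hα => by
      rw [Set.mem_toFinset] at hα
      rw [sqrtDisc_sq]
      have hK : ∀ c : K, algebraMap K (AlgebraicClosure K) c ∈ iterField p q k :=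
        fun c => (iterField p q k).algebraMap_mem c
      exact sub_mem (pow_mem (sub_mem (hK _) (mul_mem (hroot hα) (hK _))) 2)
        (mul_mem (mul_mem (ofNat_mem _ 4) (sub_mem (hK _) (mul_mem (hroot hα) (hK _))))
          (sub_mem (hK _) (mul_mem (hroot hα) (hK _)))))
    (fun α hα E hE e he d hdE => by
      rw [Set.mem_toFinset] at hα
      exact exists_val_add_mul_sqrtDisc_eq hd h' hint h (mem_rootSet.1 hα).2 E (hE (hroot hα))
        he hdE)
  rw [Set.coe_toFinset] at this
  rwa [iterField_succ hpq hd h₀ h']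

theorem valuesIn_iterField (hpq : IsCoprime p q) (hd : deg p q = 2)
    (hc : ∀ k, (iterNum p q k).coeff (2 ^ k) ≠ 0) {m : ℕ} (h : M.UnitOrbit m) :
    ValuesIn v (iterField p q m) := by
  rcases Nat.lt_or_ge m 2 with hm | hm
  · interval_cases m
    · exact valuesIn_iterField_zero p q
    · exact valuesIn_iterField_succ hpq hd (hc 0) (hc 1) (Or.inl rfl) (h.mono zero_le_one)
        (valuesIn_iterField_zero p q)
  · have hint := h.val_V_Q_le_one hm
    have : ∀ k ≤ m, ValuesIn v (iterField p q k) := by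
      intro k hk
      induction k with
      | zero => exact valuesIn_iterField_zero p q
      | succ k ih =>
        exact valuesIn_iterField_succ hpq hd (hc k) (hc (k + 1)) (Or.inr hint)
          (h.mono (by omega)) (ih (by omega))
    exact this m le_rfl

/-- The discriminants at level `m` have the values of squares of `K`. -/
theorem exists_val_fiberDisc_eq_sq (hpq : IsCoprime p q) (hd : deg p q = 2)
    (hc : ∀ k, (iterNum p q k).coeff (2 ^ k) ≠ 0) {m : ℕ} (h : M.UnitOrbit m)
    {α : AlgebraicClosure K} (hα : aeval α (iterNum p q m) = 0) :
    ∃ c : K, c ≠ 0 ∧ v (fiberDisc p q α) = v (algebraMap K (AlgebraicClosure K) c) ^ 2 := by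
  rcases Nat.lt_or_ge m 2 with hm | hm
  · interval_cases m
    · obtain rfl := aeval_iterNum_zero hα
      exact ⟨1, one_ne_zero, by rw [M.val_fiberDisc_zero]; simp⟩
    · have hu : ∀ τ : AlgebraicClosure K, v ((liftMap p q)^[1] (1, τ)).1 = 1 →
          v ((1 - M.α₁ * τ) * (1 - M.α₂ * τ)) = 1 := by
        intro τ hτ
        rwa [Function.iterate_one, liftMap, M.form_p, map_mul, M.val_a, one_mul] at hτ
      have h₁ := hu _ (h 1 le_rfl).1
      have h₂ := hu _ (h 1 le_rfl).2
      have key : ∃ c : AlgebraicClosure K,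
          (c = 1 ∨ algebraMap K (AlgebraicClosure K) M.Q ≠ 0 ∧
            (c = algebraMap K (AlgebraicClosure K) M.Q ∨
              c = (algebraMap K (AlgebraicClosure K) M.Q)⁻¹)) ∧
          v (fiberDisc p q α) = v c ^ 2 := by
        rw [M.fiberDisc_eq, map_mul v (fiberDisc p q 0), M.val_fiberDisc_zero, one_mul]
        rcases M.root_cases hd hα with rfl | rfl
        · exact val_mul_eq_sq v M.val_α M.val_ψ₁.le M.val_ψ₂.le h₁ h₂
        · exact val_mul_eq_sq v (by rw [Valuation.map_sub_swap]; exact M.val_α)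
            M.val_ψ₁.le M.val_ψ₂.le (by rwa [mul_comm]) (by rwa [mul_comm])
      obtain ⟨c, hc, e⟩ := key
      rcases hc with rfl | ⟨h0, rfl | rfl⟩
      · exact ⟨1, one_ne_zero, by rw [e]; simp⟩
      · exact ⟨M.Q, by simpa using h0, e⟩
      · exact ⟨M.Q⁻¹, by simpa using h0, by rw [e, map_inv₀ (algebraMap K _)]⟩
  · have hint := h.val_V_Q_le_one hm
    obtain ⟨y, hy, hy0, -, -, e⟩ := exists_val_scaled_fiberDisc_eq_one hd hint.1 hint.2 h hα
    have hαF : α ∈ iterField p q m :=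
      subset_adjoin K _ (mem_rootSet.2 ⟨ne_zero_of_coeff_ne_zero (hc m), hα⟩)
    have hyF : y⁻¹ ∈ iterField p q m := by
      rcases hy with rfl | rfl
      · simp
      · simpa using hαF
    obtain ⟨c, hcv⟩ := valuesIn_iterField hpq hd hc h _ hyF
    refine ⟨c, ?_, ?_⟩
    · rintro rfl
      rw [map_zero, map_zero, Valuation.zero_iff] at hcv
      exact hy0 (by simpa using hcv)
    · rw [← hcv, map_inv₀, inv_pow]
      rw [map_mul, map_pow] at e
      exact eq_inv_of_mul_eq_one_right e

/-- An element of `K` that is a square in `K_{m+1}` has even valuation. -/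
theorem exists_val_mul_sq_eq_of_sq (hpq : IsCoprime p q) (hd : deg p q = 2)
    (hc : ∀ k, (iterNum p q k).coeff (2 ^ k) ≠ 0) {m : ℕ} (h : M.UnitOrbit m) {b : K}
    {y : AlgebraicClosure K} (hy : y ∈ iterField p q (m + 1))
    (hyb : y ^ 2 = algebraMap K (AlgebraicClosure K) b) :
    ∃ c d : K, c ≠ 0 ∧ v (algebraMap K (AlgebraicClosure K) (b * c ^ 2)) =
      v (algebraMap K (AlgebraicClosure K) (d ^ 2)) := by
  classical
  have hfield : iterField p q (m + 1) = iterField p q m ⊔ adjoin K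
      ((fun α : (iterNum p q m).rootSet (AlgebraicClosure K) =>
        sqrtDisc p q (α : AlgebraicClosure K)) ''
          ((Finset.univ : Finset ((iterNum p q m).rootSet (AlgebraicClosure K))) : Set _)) := by
    rw [iterField_succ hpq hd (hc m) (hc (m + 1))]
    congr 2
    ext x
    simp
  rw [hfield] at hy
  refine exists_val_mul_sq_eq v _ (valuesIn_iterField hpq hd hc h)
    (fun α : (iterNum p q m).rootSet (AlgebraicClosure K) =>
      fiberDisc p q (α : AlgebraicClosure K)) _ (fun α => ?_) (fun α => sqrtDisc_sq p q _) _
    (fun α => exists_val_fiberDisc_eq_sq hpq hd hc h (mem_rootSet.1 α.2).2) hy hyb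
  have hK : ∀ c : K, algebraMap K (AlgebraicClosure K) c ∈ iterField p q m :=
    fun c => (iterField p q m).algebraMap_mem c
  have hα : (α : AlgebraicClosure K) ∈ iterField p q m := subset_adjoin K _ α.2
  exact sub_mem (pow_mem (sub_mem (hK _) (mul_mem hα (hK _))) 2)
    (mul_mem (mul_mem (ofNat_mem _ 4) (sub_mem (hK _) (mul_mem hα (hK _))))
      (sub_mem (hK _) (mul_mem hα (hK _))))

end UnitModel
end Ramification
end RatDyn

/-! ### The criterion -/

namespace RatDyn

section Criterion

theorem val_eq_one_iff {L Γ : Type*} [Field L] [LinearOrderedCommGroupWithZero Γ]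
    (v : Valuation L Γ) {x : L} (hx : x ≠ 0) : v x = 1 ↔ v x ≤ 1 ∧ v x⁻¹ ≤ 1 := by
  rw [map_inv₀, inv_le_one₀ (zero_lt_iff.2 ((Valuation.ne_zero_iff v).2 hx)), le_antisymm_iff]

/-- A valuation subring extending that of a valuation `u` determines which elements of the base
field are units for `u`. -/
theorem valuation_eq_one_iff_of_comap_eq {K L : Type*} [Field K] [Field L] [Algebra K L]
    {Γ : Type*} [LinearOrderedCommGroupWithZero Γ] (u : Valuation K Γ) (w : ValuationSubring L)
    (h : w.comap (algebraMap K L) = u.valuationSubring) (x : K) :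
    w.valuation (algebraMap K L x) = 1 ↔ u x = 1 := by
  have hle : ∀ x : K, w.valuation (algebraMap K L x) ≤ 1 ↔ u x ≤ 1 := fun x => by
    rw [ValuationSubring.valuation_le_one_iff, ← ValuationSubring.mem_comap, h,
      Valuation.mem_valuationSubring_iff]
  rcases eq_or_ne x 0 with rfl | hx
  · simp
  rw [val_eq_one_iff _ ((map_ne_zero (algebraMap K L)).2 hx), val_eq_one_iff u hx, ← map_inv₀, hle,
    hle]

theorem exp_mul_sq_ne_sq {m : ℤ} (hm : Odd m) {x y : WithZero (Multiplicative ℤ)} (hx : x ≠ 0)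
    (hy : y ≠ 0) : WithZero.exp m * x ^ 2 ≠ y ^ 2 := by
  rw [← WithZero.exp_log hx, ← WithZero.exp_log hy, ← WithZero.exp_nsmul, ← WithZero.exp_nsmul,
    ← WithZero.exp_add, Ne, WithZero.exp_inj]
  obtain ⟨k, rfl⟩ := hm
  simp only [nsmul_eq_mul, Nat.cast_ofNat]
  omega

variable {K : Type*} [Field K] [CharZero K]

theorem iterField_le_succ {p q : K[X]} (hpq : IsCoprime p q) (hd : deg p q = 2) {n : ℕ}
    (h : (iterNum p q n).coeff (2 ^ n) ≠ 0)
    (h' : (iterNum p q (n + 1)).coeff (2 ^ (n + 1)) ≠ 0) :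
    iterField p q n ≤ iterField p q (n + 1) := by
  rw [iterField_succ hpq hd h h']
  exact le_sup_left

/-- Let the unit conditions hold up to level `m`. If the degree of `K_{m+2}` over `K_{m+1}` is not
maximal, then `b = p_{m+2}(γ₁) p_{m+2}(γ₂)` is a square in `K_{m+1}`, which forces the value of `b`
to be that of a square of `K`. -/
theorem relfinrank_iterField_of_odd {p q : K[X]} (hpq : IsCoprime p q) (hd : deg p q = 2)
    (hc : ∀ k, (iterNum p q k).coeff (2 ^ k) ≠ 0) {m : ℕ}
    (hirr : Irreducible (iterNum p q (m + 1))) {γ₁ γ₂ : AlgebraicClosure K} (hne : γ₁ ≠ γ₂)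
    (h₁ : IsCritical p q (γ₁ : OnePoint (AlgebraicClosure K)))
    (h₂ : IsCritical p q (γ₂ : OnePoint (AlgebraicClosure K)))
    (hq₁ : aeval γ₁ q ≠ 0) (hq₂ : aeval γ₂ q ≠ 0)
    {Γ : Type*} [LinearOrderedCommGroupWithZero Γ] {v : Valuation (AlgebraicClosure K) Γ}
    {M : UnitModel p q v} (hM : M.UnitOrbit m)
    {e : K} (he : algebraMap K (AlgebraicClosure K) e = aeval γ₁ q * aeval γ₂ q)
    {b : K} (hb : algebraMap K (AlgebraicClosure K) b =
      aeval γ₁ (iterNum p q (m + 2)) * aeval γ₂ (iterNum p q (m + 2)))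
    (hodd : ∀ c d : K, c ≠ 0 → v (algebraMap K (AlgebraicClosure K) (b * c ^ 2)) ≠
      v (algebraMap K (AlgebraicClosure K) (d ^ 2))) :
    (iterField p q (m + 1)).relfinrank (iterField p q (m + 2)) = 2 ^ 2 ^ (m + 1) := by
  rw [relfinrank_iterField_succ hpq hd (hc (m + 1)) (hc (m + 2)) hirr]
  obtain ⟨c, hc0, hprod⟩ := exists_prod_fiberDisc_eq hpq hd
    (fun h => hne (OnePoint.coe_injective h)) h₁ h₂
    (ratMap_coe_eq_coe.2 ⟨hq₁, rfl⟩) (ratMap_coe_eq_coe.2 ⟨hq₂, rfl⟩)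
    (Nat.le_add_left 1 m) (hc (m + 1)) hirr
  have he0 : e ≠ 0 := by
    rintro rfl
    rw [map_zero] at he
    exact mul_ne_zero hq₁ hq₂ he.symm
  -- `b` differs from `p_{m+1}(φ(γ₁)) p_{m+1}(φ(γ₂))` by the square of a power of `e`
  have hb' : algebraMap K (AlgebraicClosure K) b =
      algebraMap K (AlgebraicClosure K) (e ^ 2 ^ m) ^ 2 *
        (aeval (aeval γ₁ p / aeval γ₁ q) (iterNum p q (m + 1)) *
          aeval (aeval γ₂ p / aeval γ₂ q) (iterNum p q (m + 1))) := by
    rw [hb, aeval_iterNum_succ_of_ne hd (m + 1) hq₁, aeval_iterNum_succ_of_ne hd (m + 1) hq₂,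
      map_pow, he, ← pow_mul, ← pow_succ, mul_pow]
    ring
  rw [exists_sq_eq_iff_of_eq_sq_mul _ hc0 hprod,
    ← exists_sq_eq_iff_of_eq_sq_mul _ (pow_ne_zero _ he0) hb']
  rintro ⟨y, hy, hyb⟩
  obtain ⟨c, d, hc0, hcd⟩ := UnitModel.exists_val_mul_sq_eq_of_sq hpq hd hc hM hy hyb
  exact hodd c d hc0 hcd

end Criterion
end RatDyn

theorem mainTheorem8 (K : Type*) [Field K] [NumberField K]
    (p q : K[X]) (hpq : IsCoprime p q) (hdeg : RatDyn.deg p q = 2) :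
    -- the criterion over `K_{n-1}`
    (∀ n : ℕ, 2 ≤ n →
      (RatDyn.ratMap p q (AlgebraicClosure K))^[n] ∞ ≠ ((0 : AlgebraicClosure K) : OnePoint _) →
      (RatDyn.ratMap p q (AlgebraicClosure K))^[n - 1] ∞ ≠
        ((0 : AlgebraicClosure K) : OnePoint _) →
      Irreducible (RatDyn.iterNum p q (n - 1)) →
      ∀ γ₁ γ₂ : OnePoint (AlgebraicClosure K), γ₁ ≠ γ₂ →
      RatDyn.IsCritical p q γ₁ → RatDyn.IsCritical p q γ₂ →
      ∀ t₁ : AlgebraicClosure K,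
      RatDyn.ratMap p q (AlgebraicClosure K) γ₁ = (t₁ : OnePoint (AlgebraicClosure K)) →
      RatDyn.iterField p q (n - 1) ≤ RatDyn.iterField p q n ∧
      (∀ t₂ : AlgebraicClosure K,
        RatDyn.ratMap p q (AlgebraicClosure K) γ₂ = (t₂ : OnePoint (AlgebraicClosure K)) →
        ((RatDyn.iterField p q (n - 1)).relfinrank (RatDyn.iterField p q n) = 2 ^ 2 ^ (n - 1) ↔
          ¬ ∃ y ∈ RatDyn.iterField p q (n - 1),
            y ^ 2 = aeval t₁ (RatDyn.iterNum p q (n - 1)) *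
              aeval t₂ (RatDyn.iterNum p q (n - 1)))) ∧
      (RatDyn.ratMap p q (AlgebraicClosure K) γ₂ = ∞ →
        ((RatDyn.iterField p q (n - 1)).relfinrank (RatDyn.iterField p q n) = 2 ^ 2 ^ (n - 1) ↔
          ¬ ∃ y ∈ RatDyn.iterField p q (n - 1),
            y ^ 2 = algebraMap K (AlgebraicClosure K)
                (RatDyn.iterNum p q (n - 1)).leadingCoeff *
              aeval t₁ (RatDyn.iterNum p q (n - 1))))) ∧
    -- the sufficient condition over `K`
    (∀ n : ℕ, 1 ≤ n →
      (∀ m : ℕ, 1 ≤ m → (RatDyn.ratMap p q (AlgebraicClosure K))^[m] ∞ ≠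
        ((0 : AlgebraicClosure K) : OnePoint _)) →
      Irreducible (RatDyn.iterNum p q (n - 1)) →
      ∀ γ₁ γ₂ : AlgebraicClosure K, γ₁ ≠ γ₂ →
      RatDyn.IsCritical p q (γ₁ : OnePoint (AlgebraicClosure K)) →
      RatDyn.IsCritical p q (γ₂ : OnePoint (AlgebraicClosure K)) →
      RatDyn.ratMap p q (AlgebraicClosure K) (γ₁ : OnePoint (AlgebraicClosure K)) ≠ ∞ →
      RatDyn.ratMap p q (AlgebraicClosure K) (γ₂ : OnePoint (AlgebraicClosure K)) ≠ ∞ →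
      ∀ 𝔭 : IsDedekindDomain.HeightOneSpectrum (NumberField.RingOfIntegers K),
      -- `w` is an extension of the `𝔭`-adic valuation to the algebraic closure
      ∀ w : ValuationSubring (AlgebraicClosure K),
      w.comap (algebraMap K (AlgebraicClosure K)) = (𝔭.valuation K).valuationSubring →
      -- the `𝔭`-adic valuation of `p_n(γ₁) p_n(γ₂) = b ∈ K` is odd
      (∃ b : K, algebraMap K (AlgebraicClosure K) b =
          aeval γ₁ (RatDyn.iterNum p q n) * aeval γ₂ (RatDyn.iterNum p q n) ∧
        ∃ m : ℤ, Odd m ∧ 𝔭.valuation K b = WithZero.exp (-m)) →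
      𝔭.valuation K p.leadingCoeff = 1 →
      𝔭.valuation K (RatDyn.critPoly p q).leadingCoeff = 1 →
      𝔭.valuation K (resultant q p) = 1 →
      𝔭.valuation K p.discr = 1 →
      (∀ j : ℕ, 2 ≤ j → j ≤ n - 1 →
        w.valuation (aeval γ₁ (RatDyn.iterNum p q j)) = 1 ∧
        w.valuation (aeval γ₂ (RatDyn.iterNum p q j)) = 1) →
      RatDyn.iterField p q (n - 1) ≤ RatDyn.iterField p q n ∧
      (RatDyn.iterField p q (n - 1)).relfinrank (RatDyn.iterField p q n) = 2 ^ 2 ^ (n - 1)) := by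
  have hco : ∀ n, (RatDyn.ratMap p q (AlgebraicClosure K))^[n] ∞ ≠
      ((0 : AlgebraicClosure K) : OnePoint _) → (RatDyn.iterNum p q n).coeff (2 ^ n) ≠ 0 :=
    fun n h => RatDyn.coeff_iterNum_ne_zero hpq hdeg h
  constructor
  · intro n hn hn' hn'' hirr γ₁ γ₂ hne h₁ h₂ t₁ ht₁
    obtain ⟨m, rfl⟩ : ∃ m, n = m + 1 := ⟨n - 1, by omega⟩
    rw [Nat.add_sub_cancel] at *
    have h := hco m hn''
    have h' := hco (m + 1) hn'
    refine ⟨RatDyn.iterField_le_succ hpq hdeg h h', fun t₂ ht₂ => ?_, fun ht₂ => ?_⟩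
    · obtain ⟨c, hc0, hprod⟩ :=
        RatDyn.exists_prod_fiberDisc_eq hpq hdeg hne h₁ h₂ ht₁ ht₂ (by omega) h hirr
      rw [RatDyn.relfinrank_iterField_succ hpq hdeg h h' hirr,
        RatDyn.exists_sq_eq_iff_of_eq_sq_mul _ hc0 hprod]
    · obtain ⟨c, hc0, hprod⟩ :=
        RatDyn.exists_prod_fiberDisc_eq_of_infty hpq hdeg h₁ h₂ ht₁ ht₂ (by omega) h hirr
      rw [RatDyn.relfinrank_iterField_succ hpq hdeg h h' hirr,
        RatDyn.exists_sq_eq_iff_of_eq_sq_mul _ hc0 hprod]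
  · rintro n hn hinf hirr γ₁ γ₂ hne h₁ h₂ hq₁ hq₂ 𝔭 w hw ⟨b, hb, j, hj, hbj⟩ hlc
      hlcc hres hdisc hunit
    obtain ⟨m, rfl⟩ : ∃ m, n = m + 1 := ⟨n - 1, by omega⟩
    rw [Nat.add_sub_cancel] at *
    have hc : ∀ k, (RatDyn.iterNum p q k).coeff (2 ^ k) ≠ 0 := by
      intro k
      rcases Nat.eq_zero_or_pos k with rfl | hk
      · simp [RatDyn.iterNum_zero]
      · exact hco k (hinf k hk)
    rw [Ne, RatDyn.ratMap_coe_eq_infty] at hq₁ hq₂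
    have hone := RatDyn.valuation_eq_one_iff_of_comap_eq _ w hw
    have h2 : p.coeff 2 ≠ 0 := by
      have := (map_ne_zero (algebraMap K K)).2 (hc 1)
      rw [RatDyn.coeff_iterNum hdeg 1] at this
      simpa [RatDyn.liftMap, RatDyn.form] using this
    obtain ⟨M, ⟨e, he⟩, hM⟩ := RatDyn.exists_unitModel hpq hdeg w.valuation h2 hne h₁ h₂ hq₁ hq₂
      ((hone _).2 hlc) ((hone _).2 hlcc) ((hone _).2 hres) ((hone _).2 hdisc)
    refine ⟨RatDyn.iterField_le_succ hpq hdeg (hc m) (hc (m + 1)), ?_⟩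
    cases m with
    | zero =>
      -- `p(γ₁) p(γ₂)` is a unit at `𝔭`, so its valuation is not odd
      have hb1 : w.valuation (algebraMap K (AlgebraicClosure K) b) = 1 := by
        rw [hb, map_mul, (hM 0).1, (hM 0).2]
        simp
      rw [hone, hbj, ← WithZero.exp_zero, WithZero.exp_inj] at hb1
      exact absurd hj (by rw [neg_eq_zero.1 hb1]; decide)
    | succ m =>
      have horb : M.UnitOrbit m := by
        intro k hk
        rcases Nat.eq_zero_or_pos k with rfl | hk0
        · simp
        · rw [← (hM k).1, ← (hM k).2]
          exact hunit (k + 1) (by omega) (by omega)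
      refine RatDyn.relfinrank_iterField_of_odd hpq hdeg hc hirr hne h₁ h₂ hq₁ hq₂ horb he hb
        fun c d hc0 hcd => ?_
      have hb0 : b ≠ 0 := by
        rintro rfl
        rw [map_zero] at hbj
        exact WithZero.exp_ne_zero hbj.symm
      have hd0 : d ≠ 0 := by
        rintro rfl
        rw [zero_pow two_ne_zero, map_zero, map_zero, Valuation.zero_iff] at hcd
        simp [hb0, hc0] at hcd
      have hquot : 𝔭.valuation K (b * c ^ 2 / d ^ 2) = 1 := by
        rw [← hone, map_div₀, map_div₀, hcd, div_self]
        simpa using hd0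
      rw [map_div₀, div_eq_one_iff_eq (by simpa using hd0), map_mul, map_pow, map_pow, hbj] at hquot
      exact RatDyn.exp_mul_sq_ne_sq hj.neg (by simpa using hc0) (by simpa using hd0) hquot
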